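/- For real $a>-1$ and $N\ge 1$, let the Laguerre unitary ensemble be the probability density on $\mathbb R^N$ given by $$P_N(\lambda)=\frac1{C_N}\prod_{l=1}^N \lambda_l^{a}e^{-\lambda_l}\chi_{\lambda_l>0}\prod_{1\le j<l\le N}|\lambda_l-\lambda_j|^2 ,$$ and let its structure function be $$S_N^{(L)}(k)=\Big\langle\Big|\sum_{j=1}^N e^{ik\lambda_j}\Big|^2\Big\rangle-\Big|\Big\langle\sum_{j=1}^N e^{ik\lambda_j}\Big\rangle\Big|^2 .$$ Let $\alpha\ge 0$, $c=\big(\tfrac{\alpha}{2+\alpha}\big)^2$ (so that $0\le c<1$), and $$\rho(x)=\frac{1}{\pi(1-\sqrt c)}\,\frac1x\sqrt{\frac{x-c}{1-x}}\;\chi_{c<x<1}$$ (Wachter's limiting Jacobi density). If $\alpha>0$, let $k_c$ be the unique number $k_c\ge0$ with $\frac1{1+k_c^2}=c$; if $\alpha=0$, put $k_c=\infty$. Then, for every real $k\ge 0$, $\rho$ is integrable on $(1/(1+k^2),1)$, and the limit $$S_\infty^{(L)}(k;\alpha)=\lim_{N\to\infty}\frac1N S_N^{(L)}(k)\Big|_{a=\alpha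 N}$$ exists and equals $\int_{1/(1+k^2)}^1\rho(x)\,dx$. Moreover, for $0\le k\le k_c$ ($k<\infty$), $$S_\infty^{(L)}(k;\alpha)=\int_{1/(1+k^2)}^1\rho(x)\,dx=\frac{2}{\pi(1-\sqrt c)}\Big(-\sqrt c\,\operatorname{Arctan}\sqrt{\frac{c(1-d)}{d-c}}+\operatorname{Arcsin}\sqrt{\frac{1-d}{1-c}}\Big),\qquad d=\frac1{1+k^2},$$ where at $k=k_c$ (that is, $d=c$) the arctangent is read as $\operatorname{Arctan}(+\infty)=\pi/2$; and for $\alpha>0$ and all $k\ge k_c$, $$S_\infty^{(L)}(k;\alpha)=1 .$$ -/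

import Mathlib

open MeasureTheory Filter Topology

noncomputable section

/-- The Laguerre weight `x ^ a * exp (-x)` on `x > 0`, and `0` elsewhere. -/
def laguerreWeight (a x : ℝ) : ℝ :=
  if 0 < x then x ^ a * Real.exp (-x) else 0

/-- The unnormalised joint eigenvalue density of the Laguerre unitary ensemble:
the product of the weights times the squared Vandermonde product over pairs `i < j`. -/
def lueUnnormalized (N : ℕ) (a : ℝ) (x : Fin N → ℝ) : ℝ :=
  (∏ i, laguerreWeight a (x i)) * ∏ i, ∏ j ∈ Finset.Ioi i, |x j - x i| ^ 2

/-- The normalisation constant of the joint eigenvalue density. -/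
def lueNormalization (N : ℕ) (a : ℝ) : ℝ :=
  ∫ x : Fin N → ℝ, lueUnnormalized N a x

/-- The joint eigenvalue probability density of the Laguerre unitary ensemble of size `N`
with parameter `a`. -/
def luePDF (N : ℕ) (a : ℝ) (x : Fin N → ℝ) : ℝ :=
  lueUnnormalized N a x / lueNormalization N a

/-- The linear statistic `∑ j, exp (i k x_j)`. -/
def fourierStatistic (N : ℕ) (k : ℝ) (x : Fin N → ℝ) : ℂ :=
  ∑ j, Complex.exp (Complex.I * (k : ℂ) * (x j : ℂ))

/-- The structure function of the Laguerre unitary ensemble: the variance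
`⟨|A|²⟩ - |⟨A⟩|²` of `A = ∑ j, exp (i k x_j)`. -/
def lueStructureFunction (N : ℕ) (a k : ℝ) : ℝ :=
  (∫ x : Fin N → ℝ, ‖fourierStatistic N k x‖ ^ 2 * luePDF N a x) -
    ‖∫ x : Fin N → ℝ, fourierStatistic N k x * (luePDF N a x : ℂ)‖ ^ 2

/-- Wachter's limiting density, supported on `(c, 1)`. -/
def wachterDensity (c x : ℝ) : ℝ :=
  if c < x ∧ x < 1 then
    1 / (Real.pi * (1 - √c)) * (1 / x) * √((x - c) / (1 - x))
  else 0

/-- `Arctan √(p / q)` for `p, q ≥ 0`, with the usual reading `Arctan (+∞) = π / 2` when the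
denominator `q` vanishes. -/
def arctanSqrtRatio (p q : ℝ) : ℝ :=
  if q = 0 then Real.pi / 2 else Real.arctan (√(p / q))

/-- The explicit `Arctan`/`Arcsin` expression, as a function of `c` and `d`. -/
def rampExpression (c d : ℝ) : ℝ :=
  2 / (Real.pi * (1 - √c)) *
    (-√c * arctanSqrtRatio (c * (1 - d)) (d - c) + Real.arcsin (√((1 - d) / (1 - c))))

end

/-!
The proof treats `e^{ikx}` as a unitary matrix. Let `J_{mn}(k)` be the matrix elements of
multiplication by `e^{ikx}` in the orthonormal polynomials of the weight `x^a e^{-x}`. Expanding the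
joint density over pairs of permutations gives `S_N(k) = N - ∑_{m,n<N} |J_{mn}(k)|²`
(`lueStructureFunction_eq`).

Multiplication by `x` is tridiagonal, so the `k`-derivative of this corner sum telescopes to a
current through the single bond between `N - 1` and `N` (`hasDerivAt_cornerNormSq`): `S_N'(k)` is
`2 √(N (N + a))` times the imaginary part of `∑_{n<N} conj(J_{N-1,n}) J_{N,n}`.

Conjugating Laguerre's differential operator by `e^{ikx}` also yields a tridiagonal operator, so for
fixed `n` the elements `J_{mn}` satisfy a three-term recurrence in `m` with spectral parameter `n`
(`laguerrePairing_recurrence`); after a change of phase its coefficients are real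
(`phasedCoeff_recurrence`). Completeness of the polynomials (`expLp_mem_closure`) supplies
`∑_n J_{ln} conj(J_{mn}) = δ_{lm}`, and the recurrence then computes every moment
`∑_n n^p J_{ln} conj(J_{mn})`. With `a = α N` and `l, m` within bounded distance of `N`, the
coefficients divided by `N` become constant, so the moments scaled by `N^p` converge to entries of
powers of a Toeplitz matrix, which are moments of `b + 2 c cos θ` (`tendsto_rowMoment`), with
`b = 1 + k²(2 + α)` and `c = k √(1 + k²) √(1 + α)`. By polarization the current is a difference of
two probability measures, and the method of moments gives its limit (`tendsto_edge_overlap`).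

Integrating in `k` by dominated convergence, `S_N(k) / N` tends to the integral over `[0, k]` of
`rampRate α`, which the substitution `x = 1 / (1 + t²)` identifies with the integral of Wachter's
density (`integral_wachterDensity`); an explicit primitive gives the closed form, and the rate
vanishes beyond the critical point.
-/

/-! ### Monic Laguerre polynomials -/

section LaguerrePolynomials

open Polynomial

/-- The monic Laguerre polynomial of degree `n` with parameter `a`, defined by its three-term
recurrence `π (n + 2) = (X - (2 n + a + 3)) π (n + 1) - (n + 1) (n + 1 + a) π n`. -/
noncomputable def monicLaguerre {K : Type*} [Field K] (a : K) : ℕ → K[X]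
  | 0 => 1
  | 1 => X - C (a + 1)
  | n + 2 => (X - C (2 * (n + 1 : K) + a + 1)) * monicLaguerre a (n + 1)
      - C ((n + 1 : K) * (n + 1 + a)) * monicLaguerre a n

variable {K : Type*} [Field K] (a : K)

/-- The recurrence in uniform form: at `n = 0` the last coefficient vanishes, so the truncated
index `n - 1` is harmless. -/
theorem monicLaguerre_succ (n : ℕ) :
    monicLaguerre a (n + 1) = (X - C (2 * (n : K) + a + 1)) * monicLaguerre a n
      - C ((n : K) * (n + a)) * monicLaguerre a (n - 1) := by
  cases n with
  | zero => simp [monicLaguerre]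
  | succ n => simp [monicLaguerre]

theorem map_monicLaguerre {L : Type*} [Field L] (f : K →+* L) (n : ℕ) :
    (monicLaguerre a n).map f = monicLaguerre (f a) n := by
  induction n using Nat.strong_induction_on with
  | _ n ih =>
    match n with
    | 0 => simp [monicLaguerre]
    | 1 => simp [monicLaguerre]
    | n + 2 => simp [monicLaguerre, ih n (by omega), ih (n + 1) (by omega), map_ofNat f 2]

theorem monicLaguerre_monic_natDegree (n : ℕ) :
    (monicLaguerre a n).Monic ∧ (monicLaguerre a n).natDegree = n := by
  induction n using Nat.strong_induction_on with
  | _ n ih =>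
    match n with
    | 0 => simp [monicLaguerre]
    | 1 => exact ⟨monic_X_sub_C _, natDegree_X_sub_C _⟩
    | n + 2 =>
      obtain ⟨h1, d1⟩ := ih (n + 1) (by omega)
      obtain ⟨h0, d0⟩ := ih n (by omega)
      have hm : ((X - C (2 * (n + 1 : K) + a + 1)) * monicLaguerre a (n + 1)).Monic :=
        (monic_X_sub_C _).mul h1
      have hd : ((X - C (2 * (n + 1 : K) + a + 1)) * monicLaguerre a (n + 1)).natDegree
          = n + 2 := by
        rw [(monic_X_sub_C _).natDegree_mul h1, natDegree_X_sub_C, d1]; omega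
      have hlt : (C ((n + 1 : K) * (n + 1 + a)) * monicLaguerre a n).degree <
          ((X - C (2 * (n + 1 : K) + a + 1)) * monicLaguerre a (n + 1)).degree := by
        refine degree_lt_degree ?_
        rw [hd]
        exact lt_of_le_of_lt (natDegree_C_mul_le _ _) (by omega)
      refine ⟨hm.sub_of_left hlt, ?_⟩
      rw [monicLaguerre, natDegree_sub_eq_left_of_natDegree_lt, hd]
      rw [hd]
      exact lt_of_le_of_lt (natDegree_C_mul_le _ _) (by omega)

/-- Structure relation `x π_n' = n π_n + n (n + a) π_{n-1}`. -/
theorem X_mul_derivative_monicLaguerre (n : ℕ) :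
    X * derivative (monicLaguerre a n) = C (n : K) * monicLaguerre a n
      + C ((n : K) * (n + a)) * monicLaguerre a (n - 1) := by
  induction n using Nat.strong_induction_on with
  | _ n ih =>
    match n with
    | 0 => simp [monicLaguerre]
    | 1 => simp [monicLaguerre]; ring
    | n + 2 =>
      have h1 := ih (n + 1) (by omega)
      have h0 := ih n (by omega)
      have r0 := monicLaguerre_succ a n
      have r1 := monicLaguerre_succ a (n + 1)
      simp only [Nat.add_sub_cancel, map_add, map_mul, Nat.cast_add, Nat.cast_one, map_one,
        show n + 2 - 1 = n + 1 by omega, show n + 1 + 1 = n + 2 by omega,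
        Nat.cast_ofNat, map_ofNat] at *
      have r1' := congrArg derivative r1
      simp only [derivative_sub, derivative_mul, derivative_X, derivative_add, derivative_C,
        derivative_one, derivative_ofNat, mul_zero, zero_mul, add_zero, sub_zero, zero_add,
        one_mul] at r1'
      rw [r1']
      linear_combination (X - (2 * (C (n : K) + 1) + C a + 1)) * h1
        - (C (n : K) + 1) * (C (n : K) + 1 + C a) * h0
        - (C (n : K) + 1) * (C (n : K) + 1 + C a) * r0
        - (C (n : K) + 2) * r1

/-- Laguerre's differential equation. -/
theorem laguerre_ode (n : ℕ) :
    X * derivative (derivative (monicLaguerre a n))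
      + (C (a + 1) - X) * derivative (monicLaguerre a n)
      + C (n : K) * monicLaguerre a n = 0 := by
  induction n using Nat.strong_induction_on with
  | _ n ih =>
    match n with
    | 0 => simp [monicLaguerre]
    | 1 => simp [monicLaguerre]
    | n + 2 =>
      have h1 := ih (n + 1) (by omega)
      have h0 := ih n (by omega)
      have s1 := X_mul_derivative_monicLaguerre a (n + 1)
      have r1 := monicLaguerre_succ a (n + 1)
      simp only [Nat.add_sub_cancel, map_add, map_mul, Nat.cast_add, Nat.cast_one, map_one,
        show n + 1 + 1 = n + 2 by omega,
        Nat.cast_ofNat, map_ofNat] at *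
      have r1' := congrArg derivative r1
      simp only [derivative_sub, derivative_mul, derivative_X, derivative_add, derivative_C,
        derivative_one, derivative_ofNat, mul_zero, zero_mul, add_zero, sub_zero, zero_add,
        one_mul] at r1'
      have r1'' := congrArg derivative r1'
      simp only [derivative_sub, derivative_mul, derivative_X, derivative_add, derivative_C,
        derivative_one, derivative_ofNat, mul_zero, zero_mul, add_zero, sub_zero, zero_add,
        one_mul] at r1''
      rw [r1'', r1', r1]
      linear_combination (X - (2 * (C (n : K) + 1) + C a + 1)) * h1
        - (C (n : K) + 1) * (C (n : K) + 1 + C a) * h0 + 2 * s1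

end LaguerrePolynomials

/-! ### The Laguerre measure and exponential moments of polynomials -/

/-- The Laguerre weight as a measure on the real line. -/
noncomputable def laguerreMeasure (a : ℝ) : Measure ℝ :=
  volume.withDensity fun x => ENNReal.ofReal (laguerreWeight a x)

theorem laguerreWeight_nonneg (a x : ℝ) : 0 ≤ laguerreWeight a x := by
  unfold laguerreWeight
  split_ifs with h
  · positivity
  · exact le_rfl

theorem measurable_laguerreWeight (a : ℝ) : Measurable (laguerreWeight a) := by
  unfold laguerreWeight
  exact Measurable.ite measurableSet_Ioi (by fun_prop) measurable_const

section LaguerreMeasure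

variable {E : Type*} [NormedAddCommGroup E] [NormedSpace ℝ E]

theorem integral_laguerreMeasure (a : ℝ) (f : ℝ → E) :
    ∫ x, f x ∂laguerreMeasure a = ∫ x, laguerreWeight a x • f x := by
  rw [laguerreMeasure, integral_withDensity_eq_integral_toReal_smul
    (measurable_laguerreWeight a).ennreal_ofReal (by simp)]
  simp [ENNReal.toReal_ofReal (laguerreWeight_nonneg a _)]

theorem integrable_laguerreMeasure_iff (a : ℝ) (f : ℝ → E) :
    Integrable f (laguerreMeasure a) ↔ Integrable fun x => laguerreWeight a x • f x := by
  rw [laguerreMeasure, integrable_withDensity_iff_integrable_smul'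
    (measurable_laguerreWeight a).ennreal_ofReal (by simp)]
  simp [ENNReal.toReal_ofReal (laguerreWeight_nonneg a _)]

theorem laguerreWeight_smul_eq_indicator (a : ℝ) (f : ℝ → E) :
    (fun x => laguerreWeight a x • f x)
      = (Set.Ioi 0).indicator fun x : ℝ => (x ^ a * Real.exp (-x)) • f x := by
  ext x
  by_cases hx : 0 < x <;> simp [laguerreWeight, hx]

theorem integral_laguerreMeasure_Ioi (a : ℝ) (f : ℝ → E) :
    ∫ x, f x ∂laguerreMeasure a = ∫ x in Set.Ioi (0 : ℝ), (x ^ a * Real.exp (-x)) • f x := by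
  rw [integral_laguerreMeasure, laguerreWeight_smul_eq_indicator,
    integral_indicator measurableSet_Ioi]

theorem integrable_laguerreMeasure_iff_Ioi (a : ℝ) (f : ℝ → E) :
    Integrable f (laguerreMeasure a)
      ↔ IntegrableOn (fun x : ℝ => (x ^ a * Real.exp (-x)) • f x) (Set.Ioi 0) := by
  rw [integrable_laguerreMeasure_iff, laguerreWeight_smul_eq_indicator,
    integrable_indicator_iff measurableSet_Ioi]

theorem integrable_pow_mul_exp_laguerreMeasure {a c : ℝ} (ha : 0 ≤ a) (hc : c < 1) (n : ℕ) :
    Integrable (fun x : ℝ => |x| ^ n * Real.exp (c * |x|)) (laguerreMeasure a) := by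
  rw [integrable_laguerreMeasure_iff_Ioi]
  have h := integrableOn_rpow_mul_exp_neg_mul_rpow (p := 1) (s := a + n) (b := 1 - c)
    (by linarith [n.cast_nonneg (α := ℝ)]) one_pos (by linarith)
  refine h.congr_fun (fun x hx => ?_) measurableSet_Ioi
  have hx' : 0 < x := hx
  simp only [Real.rpow_one, smul_eq_mul, abs_of_pos hx']
  rw [Real.rpow_add hx', Real.rpow_natCast,
    show -(1 - c) * x = -x + c * x by ring, Real.exp_add]
  ring

end LaguerreMeasure

section ExpMoment

open Polynomial

theorem norm_exp_I_mul (k x : ℝ) : ‖Complex.exp (Complex.I * (k : ℂ) * (x : ℂ))‖ = 1 := by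
  rw [show Complex.I * (k : ℂ) * (x : ℂ) = ((k * x : ℝ) : ℂ) * Complex.I by push_cast; ring]
  exact Complex.norm_exp_ofReal_mul_I _

theorem integrable_eval_mul_of_norm_le_exp {a b c : ℝ} (ha : 0 ≤ a) (hc : c < 1) (R : ℂ[X])
    {g : ℝ → ℂ} (hg : Measurable g) (hb : ∀ x, ‖g x‖ ≤ b * Real.exp (c * |x|)) :
    Integrable (fun x : ℝ => R.eval (x : ℂ) * g x) (laguerreMeasure a) := by
  induction R using Polynomial.induction_on' with
  | add p q hp hq =>
    simp only [eval_add, add_mul]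
    exact hp.add hq
  | monomial n z =>
    have h := (integrable_pow_mul_exp_laguerreMeasure ha hc n).const_mul (‖z‖ * b)
    refine h.mono' (by simp only [eval_monomial]; fun_prop) (ae_of_all _ fun x => ?_)
    simp only [eval_monomial, norm_mul, norm_pow, Complex.norm_real, Real.norm_eq_abs]
    calc ‖z‖ * |x| ^ n * ‖g x‖ ≤ ‖z‖ * |x| ^ n * (b * Real.exp (c * |x|)) := by
          gcongr; exact hb x
      _ = ‖z‖ * b * (|x| ^ n * Real.exp (c * |x|)) := by ring

theorem integrable_eval_mul_of_norm_le {a : ℝ} (ha : 0 ≤ a) (R : ℂ[X]) {g : ℝ → ℂ}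
    (hg : Measurable g) {b : ℝ} (hb : ∀ x, ‖g x‖ ≤ b) :
    Integrable (fun x : ℝ => R.eval (x : ℂ) * g x) (laguerreMeasure a) :=
  integrable_eval_mul_of_norm_le_exp ha zero_lt_one R hg (b := b) (by simpa using hb)

/-- The functional `R ↦ ∫ R(x) e^{ikx} x^a e^{-x} dx` on polynomials. -/
noncomputable def expMoment (a k : ℝ) (R : ℂ[X]) : ℂ :=
  ∫ x : ℝ, R.eval (x : ℂ) * Complex.exp (Complex.I * (k : ℂ) * (x : ℂ)) ∂laguerreMeasure a

theorem integrable_expMoment {a : ℝ} (ha : 0 ≤ a) (k : ℝ) (R : ℂ[X]) :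
    Integrable (fun x : ℝ => R.eval (x : ℂ) * Complex.exp (Complex.I * (k : ℂ) * (x : ℂ)))
      (laguerreMeasure a) :=
  integrable_eval_mul_of_norm_le ha R (by fun_prop) (b := 1) fun x => (norm_exp_I_mul k x).le

theorem expMoment_add {a : ℝ} (ha : 0 ≤ a) (k : ℝ) (R S : ℂ[X]) :
    expMoment a k (R + S) = expMoment a k R + expMoment a k S := by
  unfold expMoment
  rw [← integral_add (integrable_expMoment ha k R) (integrable_expMoment ha k S)]
  simp [add_mul]

theorem expMoment_C_mul (a k : ℝ) (z : ℂ) (R : ℂ[X]) :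
    expMoment a k (C z * R) = z * expMoment a k R := by
  unfold expMoment
  rw [← integral_const_mul]
  simp [mul_assoc]

theorem expMoment_sub {a : ℝ} (ha : 0 ≤ a) (k : ℝ) (R S : ℂ[X]) :
    expMoment a k (R - S) = expMoment a k R - expMoment a k S := by
  have h := expMoment_add ha k R (C (-1) * S)
  rw [expMoment_C_mul] at h
  rw [sub_eq_add_neg, sub_eq_add_neg, ← neg_one_mul (expMoment a k S), ← h]
  simp

/-- Integration by parts against `x^{a+1} e^{-x} e^{ikx}`. -/
theorem expMoment_pearson {a : ℝ} (ha : 0 ≤ a) (k : ℝ) (R : ℂ[X]) :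
    expMoment a k (C ((a : ℂ) + 1) * R + C (Complex.I * k - 1) * (X * R) + X * derivative R)
      = 0 := by
  induction R using Polynomial.induction_on' with
  | add p q hp hq =>
    have := congrArg₂ (· + ·) hp hq
    simp only [← expMoment_add ha, add_zero] at this
    rw [← this]
    congr 1
    simp only [derivative_add]
    ring
  | monomial n z =>
    have hint := integrable_expMoment ha k (C ((a : ℂ) + 1) * monomial n z
      + C (Complex.I * k - 1) * (X * monomial n z) + X * derivative (monomial n z))
    rw [integrable_laguerreMeasure_iff_Ioi] at hint
    have hder : ∀ x ∈ Set.Ici (0 : ℝ), HasDerivAt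
        (fun x : ℝ => z * (((x ^ (a + 1 + n) : ℝ) : ℂ) * Complex.exp ((Complex.I * k - 1) * x)))
        (z * ((((a + 1 + n) * x ^ (a + 1 + n - 1) : ℝ) : ℂ) * Complex.exp ((Complex.I * k - 1) * x)
          + ((x ^ (a + 1 + n) : ℝ) : ℂ) * (Complex.exp ((Complex.I * k - 1) * x)
            * (Complex.I * k - 1)))) x := by
      intro x _
      have h1 : HasDerivAt (fun x : ℝ => ((x ^ (a + 1 + n) : ℝ) : ℂ))
          (((a + 1 + n) * x ^ (a + 1 + n - 1) : ℝ) : ℂ) x :=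
        (Real.hasDerivAt_rpow_const (Or.inr (by linarith [n.cast_nonneg (α := ℝ)]))).ofReal_comp
      have h2 : HasDerivAt (fun x : ℝ => Complex.exp ((Complex.I * k - 1) * x))
          (Complex.exp ((Complex.I * k - 1) * x) * (Complex.I * k - 1)) x := by
        have h3 : HasDerivAt (fun y : ℂ => Complex.exp ((Complex.I * k - 1) * y))
          (Complex.exp ((Complex.I * k - 1) * x) * (Complex.I * k - 1)) x := by
          simpa using ((hasDerivAt_id (x : ℂ)).const_mul (Complex.I * k - 1)).cexp
        exact h3.comp_ofReal
      exact (h1.mul h2).const_mul z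
    have heq : Set.EqOn (fun x : ℝ => (x ^ a * Real.exp (-x)) •
        ((C ((a : ℂ) + 1) * monomial n z
          + C (Complex.I * k - 1) * (X * monomial n z) + X * derivative (monomial n z)).eval (x : ℂ)
          * Complex.exp (Complex.I * (k : ℂ) * (x : ℂ))))
        (fun x : ℝ => z * ((((a + 1 + n) * x ^ (a + 1 + n - 1) : ℝ) : ℂ)
          * Complex.exp ((Complex.I * k - 1) * x)
          + ((x ^ (a + 1 + n) : ℝ) : ℂ) * (Complex.exp ((Complex.I * k - 1) * x)
            * (Complex.I * k - 1)))) (Set.Ioi 0) := by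
      intro x hx
      have hx' : 0 < x := hx
      have e1 : x ^ (a + 1 + n - 1) = x ^ a * x ^ n := by
        rw [← Real.rpow_natCast, ← Real.rpow_add hx']; congr 1; ring
      have e2 : x ^ (a + 1 + n) = x ^ a * x ^ n * x := by
        rw [← e1, ← Real.rpow_add_one hx'.ne']; congr 1; ring
      have e3 : Complex.exp ((Complex.I * k - 1) * x)
          = Complex.exp (-x) * Complex.exp (Complex.I * k * x) := by
        rw [← Complex.exp_add]; congr 1; ring
      have e4 : (x : ℂ) * ((n : ℂ) * z * (x : ℂ) ^ (n - 1)) = n * z * (x : ℂ) ^ n := by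
        cases n with
        | zero => simp
        | succ n => simp [pow_succ]; ring
      simp only [derivative_monomial, eval_add, eval_mul, eval_C, eval_monomial, eval_X, e1, e2,
        e3, Complex.real_smul]
      push_cast
      rw [mul_comm z (n : ℂ), e4]
      ring
    have hlim : Tendsto (fun x : ℝ => z * (((x ^ (a + 1 + n) : ℝ) : ℂ)
        * Complex.exp ((Complex.I * k - 1) * x))) atTop (𝓝 0) := by
      rw [tendsto_zero_iff_norm_tendsto_zero]
      have h := (tendsto_rpow_mul_exp_neg_mul_atTop_nhds_zero (a + 1 + n) 1 one_pos).const_mul ‖z‖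
      rw [mul_zero] at h
      refine h.congr' ?_
      filter_upwards [eventually_ge_atTop 0] with x hx
      rw [norm_mul, norm_mul, Complex.norm_real, Complex.norm_exp,
        Real.norm_of_nonneg (Real.rpow_nonneg hx _)]
      simp
    have hFTC := integral_Ioi_of_hasDerivAt_of_tendsto' hder
      (hint.congr_fun heq measurableSet_Ioi) hlim
    rw [expMoment, integral_laguerreMeasure_Ioi, setIntegral_congr_fun measurableSet_Ioi heq, hFTC]
    have : (0 : ℝ) ^ (a + 1 + n) = 0 :=
      Real.zero_rpow (by linarith [n.cast_nonneg (α := ℝ)] : (0 : ℝ) < a + 1 + n).ne'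
    simp [this]

theorem hasDerivAt_expMoment {a : ℝ} (ha : 0 ≤ a) (k : ℝ) (R : ℂ[X]) :
    HasDerivAt (fun k => expMoment a k R) (Complex.I * expMoment a k (X * R)) k := by
  have hI := integrable_eval_mul_of_norm_le ha (X * R) (g := fun _ => 1) measurable_const
    (b := 1) (by simp)
  obtain ⟨G, hG⟩ : ∃ G : ℝ → ℝ → ℂ, G = fun (k x : ℝ) => Complex.I * ((X * R).eval (x : ℂ)
      * Complex.exp (Complex.I * (k : ℂ) * (x : ℂ))) := ⟨_, rfl⟩
  obtain ⟨F, hF⟩ : ∃ F : ℝ → ℝ → ℂ, F = fun (k x : ℝ) => R.eval (x : ℂ)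
      * Complex.exp (Complex.I * (k : ℂ) * (x : ℂ)) := ⟨_, rfl⟩
  have hbound : ∀ x k : ℝ, ‖G k x‖ ≤ ‖(X * R).eval (x : ℂ) * 1‖ := by
    intro x k
    rw [hG]
    simp only [norm_mul, norm_exp_I_mul, Complex.norm_I, mul_one, one_mul, le_refl]
  have hderiv : ∀ x k : ℝ, HasDerivAt (fun k : ℝ => F k x) (G k x) k := by
    intro x k
    have h3 : HasDerivAt (fun y : ℂ => Complex.exp (Complex.I * y * x))
        (Complex.exp (Complex.I * k * x) * (Complex.I * x)) (k : ℂ) := by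
      simpa using (((hasDerivAt_id (k : ℂ)).const_mul Complex.I).mul_const (x : ℂ)).cexp
    rw [hF, hG]
    convert! (h3.comp_ofReal).const_mul (R.eval (x : ℂ)) using 1
    simp only [eval_mul, eval_X]
    ring
  have hFint : ∀ k, Integrable (F k) (laguerreMeasure a) := by
    rw [hF]; exact fun k => integrable_expMoment ha k R
  have hGint : Integrable (G k) (laguerreMeasure a) := by
    rw [hG]; exact (integrable_expMoment ha k (X * R)).const_mul _
  have h := (hasDerivAt_integral_of_dominated_loc_of_deriv_le (μ := laguerreMeasure a)
    (F := F) (F' := G) (x₀ := k) (s := Set.univ) Filter.univ_mem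
    (Eventually.of_forall fun k => (hFint k).aestronglyMeasurable)
    (hFint k) hGint.aestronglyMeasurable
    (ae_of_all _ fun x k _ => hbound x k) hI.norm
    (ae_of_all _ fun x k _ => hderiv x k)).2
  have e1 : (fun k => expMoment a k R) = fun k => ∫ x, F k x ∂laguerreMeasure a := by
    rw [hF]; rfl
  have e2 : Complex.I * expMoment a k (X * R) = ∫ x, G k x ∂laguerreMeasure a := by
    rw [hG, expMoment, ← integral_const_mul]
  rw [e1, e2]
  exact h

end ExpMoment

/-! ### Matrix elements of `e^{ikx}` in the Laguerre basis -/

section MatrixElements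

open Polynomial

variable {a : ℝ}

/-- The matrix element `∫ π_m π_n e^{ikx} dμ` in the monic Laguerre polynomials. -/
noncomputable def laguerrePairing (a k : ℝ) (m n : ℕ) : ℂ :=
  expMoment a k (monicLaguerre (a : ℂ) m * monicLaguerre (a : ℂ) n)

theorem laguerrePairing_comm (a k : ℝ) (m n : ℕ) :
    laguerrePairing a k m n = laguerrePairing a k n m := by
  rw [laguerrePairing, mul_comm, ← laguerrePairing]

/-- Three-term recurrence in one index with spectral parameter the other index: conjugating
Laguerre's operator by `e^{ikx}` yields a tridiagonal operator. -/
theorem laguerrePairing_recurrence (ha : 0 ≤ a) (k : ℝ) (m n : ℕ) :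
    (n : ℂ) * laguerrePairing a k m n
      = (m + (k : ℂ) ^ 2 * (2 * m + a + 1)) * laguerrePairing a k m n
        + ((k : ℂ) ^ 2 + Complex.I * k) * laguerrePairing a k (m + 1) n
        + ((k : ℂ) ^ 2 - Complex.I * k) * (m * (m + a)) * laguerrePairing a k (m - 1) n := by
  set p := monicLaguerre (a : ℂ) m with hp
  set q := monicLaguerre (a : ℂ) n with hq
  set p₁ := monicLaguerre (a : ℂ) (m + 1) with hp₁
  set p₀ := monicLaguerre (a : ℂ) (m - 1) with hp₀
  have h := expMoment_pearson ha k
    (C (Complex.I * k) * (p * q) + derivative p * q - p * derivative q)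
  have hpoly : C ((a : ℂ) + 1) * (C (Complex.I * k) * (p * q) + derivative p * q - p * derivative q)
      + C (Complex.I * k - 1)
        * (X * (C (Complex.I * k) * (p * q) + derivative p * q - p * derivative q))
      + X * derivative (C (Complex.I * k) * (p * q) + derivative p * q - p * derivative q)
      = C ((n : ℂ) - (m + (k : ℂ) ^ 2 * (2 * m + a + 1))) * (p * q)
        - C ((k : ℂ) ^ 2 + Complex.I * k) * (p₁ * q)
        - C (((k : ℂ) ^ 2 - Complex.I * k) * (m * (m + a))) * (p₀ * q) := by
    have hI : (C Complex.I : ℂ[X]) ^ 2 = -1 := by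
      rw [← map_pow, Complex.I_sq]; simp
    have o1 := laguerre_ode (a : ℂ) m
    have o2 := laguerre_ode (a : ℂ) n
    have s1 := X_mul_derivative_monicLaguerre (a : ℂ) m
    have r1 := monicLaguerre_succ (a : ℂ) m
    rw [← hp, ← hp₀] at s1
    rw [← hp, ← hp₁, ← hp₀] at r1
    rw [← hp] at o1
    rw [← hq] at o2
    simp only [derivative_mul, derivative_C, zero_mul, zero_add, map_add, map_mul, map_sub, map_pow,
      map_one, map_ofNat] at *
    linear_combination q * o1 - p * o2 + 2 * C Complex.I * C (k : ℂ) * q * s1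
      + (C (k : ℂ) ^ 2 + C Complex.I * C (k : ℂ)) * q * r1 + C (k : ℂ) ^ 2 * X * p * q * hI
  rw [hpoly, expMoment_sub ha, expMoment_sub ha, expMoment_C_mul, expMoment_C_mul,
    expMoment_C_mul] at h
  simp only [laguerrePairing, ← hp, ← hq, ← hp₁, ← hp₀]
  linear_combination h

theorem expMoment_X_mul_monicLaguerre (ha : 0 ≤ a) (k : ℝ) (m n : ℕ) :
    expMoment a k (X * (monicLaguerre (a : ℂ) m * monicLaguerre (a : ℂ) n))
      = laguerrePairing a k m (n + 1) + (2 * n + a + 1) * laguerrePairing a k m n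
        + n * (n + a) * laguerrePairing a k m (n - 1) := by
  simp only [laguerrePairing]
  rw [← expMoment_C_mul, ← expMoment_C_mul, ← expMoment_add ha, ← expMoment_add ha]
  congr 1
  rw [monicLaguerre_succ (a : ℂ) n]
  ring

theorem laguerrePairing_zero_of_ne (ha : 0 ≤ a) {m n : ℕ} (hmn : m ≠ n) :
    laguerrePairing a 0 m n = 0 := by
  have h := laguerrePairing_recurrence ha 0 m n
  have h2 : ((n : ℂ) - m) * laguerrePairing a 0 m n = 0 := by
    push_cast at h
    linear_combination h
  exact (mul_eq_zero.mp h2).resolve_left (sub_ne_zero.mpr (by exact_mod_cast hmn.symm))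

/-- The squared norm `n! Γ(n + a + 1)` of the monic Laguerre polynomial, as a product. -/
noncomputable def laguerreNormSq (a : ℝ) (n : ℕ) : ℝ :=
  Real.Gamma (a + 1) * ∏ i ∈ Finset.range n, ((i + 1 : ℝ) * (i + 1 + a))

theorem laguerreNormSq_pos (ha : 0 ≤ a) (n : ℕ) : 0 < laguerreNormSq a n :=
  mul_pos (Real.Gamma_pos_of_pos (by linarith)) (Finset.prod_pos fun i _ => by positivity)

theorem laguerreNormSq_succ (a : ℝ) (n : ℕ) :
    laguerreNormSq a (n + 1) = (n + 1 : ℝ) * (n + 1 + a) * laguerreNormSq a n := by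
  rw [laguerreNormSq, laguerreNormSq, Finset.prod_range_succ]
  ring

theorem laguerrePairing_zero_self (ha : 0 ≤ a) (n : ℕ) :
    laguerrePairing a 0 n n = laguerreNormSq a n := by
  induction n with
  | zero =>
    rw [laguerrePairing, expMoment, integral_laguerreMeasure_Ioi]
    simp only [monicLaguerre, mul_one, eval_one, Complex.ofReal_zero, mul_zero, zero_mul,
      Complex.exp_zero, laguerreNormSq, Finset.range_zero, Finset.prod_empty]
    rw [integral_smul_const, Real.Gamma_eq_integral (by linarith)]
    simp [mul_comm]
  | succ n ih =>
    have h1 := expMoment_X_mul_monicLaguerre ha 0 (n + 1) n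
    have h2 := expMoment_X_mul_monicLaguerre ha 0 n (n + 1)
    rw [mul_comm (monicLaguerre (a : ℂ) (n + 1))] at h1
    rw [h1, laguerrePairing_zero_of_ne ha (show n + 1 ≠ n by omega),
      laguerrePairing_zero_of_ne ha (show n + 1 ≠ n - 1 by omega),
      laguerrePairing_zero_of_ne ha (show n ≠ n + 1 + 1 by omega),
      laguerrePairing_zero_of_ne ha (show n ≠ n + 1 by omega), Nat.add_sub_cancel, ih] at h2
    rw [laguerreNormSq_succ]
    push_cast at h2 ⊢
    linear_combination h2

/-- The off-diagonal entry `√(n (n + a))` of the Jacobi matrix of the Laguerre weight. -/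
noncomputable def laguerreOffDiag (a : ℝ) (n : ℕ) : ℝ := √((n : ℝ) * (n + a))

@[simp] theorem laguerreOffDiag_zero (a : ℝ) : laguerreOffDiag a 0 = 0 := by
  simp [laguerreOffDiag]

theorem laguerreOffDiag_pos (ha : 0 ≤ a) (n : ℕ) : 0 < laguerreOffDiag a (n + 1) :=
  Real.sqrt_pos.mpr (by push_cast; positivity)

theorem laguerreOffDiag_sq (ha : 0 ≤ a) (n : ℕ) :
    laguerreOffDiag a n ^ 2 = (n : ℝ) * (n + a) := Real.sq_sqrt (by positivity)

theorem sqrt_laguerreNormSq_succ (ha : 0 ≤ a) (n : ℕ) :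
    √(laguerreNormSq a (n + 1)) = laguerreOffDiag a (n + 1) * √(laguerreNormSq a n) := by
  rw [laguerreNormSq_succ, Real.sqrt_mul (by positivity), laguerreOffDiag]
  push_cast
  rfl

theorem sqrt_laguerreNormSq_pos (ha : 0 ≤ a) (n : ℕ) : 0 < √(laguerreNormSq a n) :=
  Real.sqrt_pos.mpr (laguerreNormSq_pos ha n)

/-- The matrix element of `e^{ikx}` in the orthonormal Laguerre polynomials. -/
noncomputable def laguerreCoeff (a k : ℝ) (m n : ℕ) : ℂ :=
  laguerrePairing a k m n / (√(laguerreNormSq a m) * √(laguerreNormSq a n) : ℝ)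

theorem laguerreCoeff_comm (a k : ℝ) (m n : ℕ) :
    laguerreCoeff a k m n = laguerreCoeff a k n m := by
  rw [laguerreCoeff, laguerrePairing_comm, mul_comm, ← laguerreCoeff]

theorem laguerreCoeff_zero (ha : 0 ≤ a) (m n : ℕ) :
    laguerreCoeff a 0 m n = if m = n then 1 else 0 := by
  split_ifs with h
  · subst h
    rw [laguerreCoeff, laguerrePairing_zero_self ha,
      Real.mul_self_sqrt (laguerreNormSq_pos ha m).le]
    exact div_self (by exact_mod_cast (laguerreNormSq_pos ha m).ne')
  · rw [laguerreCoeff, laguerrePairing_zero_of_ne ha h, zero_div]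

theorem laguerrePairing_eq (ha : 0 ≤ a) (k : ℝ) (m n : ℕ) :
    laguerrePairing a k m n
      = laguerreCoeff a k m n * ((√(laguerreNormSq a m) : ℂ) * √(laguerreNormSq a n)) := by
  rw [laguerreCoeff, Complex.ofReal_mul, div_mul_cancel₀]
  exact_mod_cast (mul_pos (sqrt_laguerreNormSq_pos ha m) (sqrt_laguerreNormSq_pos ha n)).ne'

theorem laguerreCoeff_recurrence (ha : 0 ≤ a) (k : ℝ) (m n : ℕ) :
    (n : ℂ) * laguerreCoeff a k m n
      = (m + (k : ℂ) ^ 2 * (2 * m + a + 1)) * laguerreCoeff a k m n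
        + ((k : ℂ) ^ 2 + Complex.I * k) * laguerreOffDiag a (m + 1) * laguerreCoeff a k (m + 1) n
        + ((k : ℂ) ^ 2 - Complex.I * k) * laguerreOffDiag a m * laguerreCoeff a k (m - 1) n := by
  have h := laguerrePairing_recurrence ha k m n
  have hm : (√(laguerreNormSq a m) : ℂ) ≠ 0 := by
    exact_mod_cast (sqrt_laguerreNormSq_pos ha m).ne'
  have hn : (√(laguerreNormSq a n) : ℂ) ≠ 0 := by
    exact_mod_cast (sqrt_laguerreNormSq_pos ha n).ne'
  simp only [laguerrePairing_eq ha, sqrt_laguerreNormSq_succ ha m] at h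
  refine mul_right_cancel₀ (mul_ne_zero hm hn) ?_
  cases m with
  | zero =>
    simp only [laguerreOffDiag_zero] at h ⊢
    push_cast at h ⊢
    linear_combination h
  | succ m =>
    have hs := laguerreOffDiag_sq ha (m + 1)
    rw [Nat.add_sub_cancel] at h ⊢
    rw [sqrt_laguerreNormSq_succ ha m] at h ⊢
    have hs' : (laguerreOffDiag a (m + 1) : ℂ) ^ 2 = ((m : ℂ) + 1) * (m + 1 + a) := by
      exact_mod_cast hs
    push_cast at h ⊢
    linear_combination h - ((k : ℂ) ^ 2 - Complex.I * k) * laguerreCoeff a k m n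
      * √(laguerreNormSq a m) * √(laguerreNormSq a n) * hs'

theorem hasDerivAt_laguerreCoeff (ha : 0 ≤ a) (k : ℝ) (m n : ℕ) :
    HasDerivAt (fun k => laguerreCoeff a k m n)
      (Complex.I * (laguerreOffDiag a (n + 1) * laguerreCoeff a k m (n + 1)
        + (2 * n + a + 1) * laguerreCoeff a k m n
        + laguerreOffDiag a n * laguerreCoeff a k m (n - 1))) k := by
  have h := (hasDerivAt_expMoment ha k
    (monicLaguerre (a : ℂ) m * monicLaguerre (a : ℂ) n)).div_const
    ((√(laguerreNormSq a m) * √(laguerreNormSq a n) : ℝ) : ℂ)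
  rw [expMoment_X_mul_monicLaguerre ha] at h
  convert! h using 1
  have hm : (√(laguerreNormSq a m) : ℂ) ≠ 0 := by
    exact_mod_cast (sqrt_laguerreNormSq_pos ha m).ne'
  have hn : (√(laguerreNormSq a n) : ℂ) ≠ 0 := by
    exact_mod_cast (sqrt_laguerreNormSq_pos ha n).ne'
  rw [Complex.ofReal_mul, eq_div_iff (mul_ne_zero hm hn)]
  simp only [laguerrePairing_eq ha, sqrt_laguerreNormSq_succ ha n]
  cases n with
  | zero =>
    simp only [laguerreOffDiag_zero]
    push_cast
    ring
  | succ n =>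
    have hs := laguerreOffDiag_sq ha (n + 1)
    have hs' : (laguerreOffDiag a (n + 1) : ℂ) ^ 2 = ((n : ℂ) + 1) * (n + 1 + a) := by
      exact_mod_cast hs
    rw [Nat.add_sub_cancel, sqrt_laguerreNormSq_succ ha n]
    push_cast
    linear_combination Complex.I * laguerreCoeff a k m n
      * √(laguerreNormSq a m) * √(laguerreNormSq a n) * hs'

/-- The unimodular factor which makes the tridiagonal operator in
`laguerreCoeff_recurrence` real symmetric. -/
noncomputable def laguerrePhase (k : ℝ) : ℂ := (k + Complex.I) / (√(1 + k ^ 2) : ℝ)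

theorem norm_laguerrePhase (k : ℝ) : ‖laguerrePhase k‖ = 1 := by
  have h : ‖(k : ℂ) + Complex.I‖ = √(1 + k ^ 2) := by
    rw [Complex.norm_def, Complex.normSq_apply]
    congr 1
    simp
    ring
  rw [laguerrePhase, norm_div, h, Complex.norm_real, Real.norm_of_nonneg (Real.sqrt_nonneg _)]
  exact div_self (Real.sqrt_pos.mpr (by positivity)).ne'

theorem sqrt_mul_laguerrePhase (k : ℝ) :
    (√(1 + k ^ 2) : ℂ) * laguerrePhase k = k + Complex.I := by
  rw [laguerrePhase, mul_div_cancel₀]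
  exact_mod_cast (Real.sqrt_pos.mpr (by positivity : 0 < 1 + k ^ 2)).ne'

theorem conj_mul_laguerrePhase (k : ℝ) :
    (starRingEnd ℂ) (laguerrePhase k) * laguerrePhase k = 1 := by
  rw [mul_comm, Complex.mul_conj, Complex.normSq_eq_norm_sq, norm_laguerrePhase]
  simp

/-- The matrix elements of `e^{ikx}` with the phases adjusted in the first index. -/
noncomputable def phasedCoeff (a k : ℝ) (m n : ℕ) : ℂ := laguerrePhase k ^ m * laguerreCoeff a k m n

theorem phasedCoeff_recurrence (ha : 0 ≤ a) (k : ℝ) (m n : ℕ) :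
    (n : ℂ) * phasedCoeff a k m n
      = ((m + k ^ 2 * (2 * m + a + 1) : ℝ) : ℂ) * phasedCoeff a k m n
        + ((k * √(1 + k ^ 2) * laguerreOffDiag a (m + 1) : ℝ) : ℂ) * phasedCoeff a k (m + 1) n
        + ((k * √(1 + k ^ 2) * laguerreOffDiag a m : ℝ) : ℂ) * phasedCoeff a k (m - 1) n := by
  have h := laguerreCoeff_recurrence ha k m n
  have hz := sqrt_mul_laguerrePhase k
  have hzz := conj_mul_laguerrePhase k
  have hz' : (√(1 + k ^ 2) : ℂ) * (starRingEnd ℂ) (laguerrePhase k) = k - Complex.I := by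
    have := congrArg (starRingEnd ℂ) hz
    simpa [← sub_eq_add_neg] using this
  have hs : (√(1 + k ^ 2) : ℂ) = (k - Complex.I) * laguerrePhase k := by
    rw [← hz']; linear_combination -(√(1 + k ^ 2) : ℂ) * hzz
  simp only [phasedCoeff]
  cases m with
  | zero =>
    simp only [laguerreOffDiag_zero] at h ⊢
    push_cast at h ⊢
    linear_combination h - k * laguerreOffDiag a 1 * laguerreCoeff a k 1 n * hz
  | succ m =>
    rw [Nat.add_sub_cancel] at h ⊢
    push_cast at h ⊢
    linear_combination laguerrePhase k ^ (m + 1) * h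
      - k * laguerreOffDiag a (m + 1 + 1) * laguerrePhase k ^ (m + 1)
        * laguerreCoeff a k (m + 1 + 1) n * hz
      - k * laguerreOffDiag a (m + 1) * laguerrePhase k ^ m * laguerreCoeff a k m n * hs

/-- Since the recurrence has real coefficients, neighbouring phased matrix elements are real
multiples of each other. -/
theorem im_conj_phasedCoeff_mul_succ (ha : 0 ≤ a) {k : ℝ} (hk : 0 < k) (m n : ℕ) :
    ((starRingEnd ℂ) (phasedCoeff a k m n) * phasedCoeff a k (m + 1) n).im = 0 := by
  have key : ∀ m, (k * √(1 + k ^ 2) * laguerreOffDiag a (m + 1))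
      * ((starRingEnd ℂ) (phasedCoeff a k m n) * phasedCoeff a k (m + 1) n).im
      = -(k * √(1 + k ^ 2) * laguerreOffDiag a m)
      * ((starRingEnd ℂ) (phasedCoeff a k m n) * phasedCoeff a k (m - 1) n).im := by
    intro m
    have h := congrArg (fun w => ((starRingEnd ℂ) (phasedCoeff a k m n) * w).im)
      (phasedCoeff_recurrence ha k m n)
    simp only [Complex.mul_im, Complex.conj_re, Complex.conj_im, Complex.add_im, Complex.add_re,
      Complex.mul_re, Complex.natCast_re, Complex.natCast_im, Complex.ofReal_re,
      Complex.ofReal_im] at h ⊢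
    linear_combination -h
  have hpos : ∀ m, k * √(1 + k ^ 2) * laguerreOffDiag a (m + 1) ≠ 0 := fun m =>
    (mul_pos (mul_pos hk (Real.sqrt_pos.mpr (by positivity))) (laguerreOffDiag_pos ha m)).ne'
  induction m with
  | zero =>
    have h := key 0
    simp only [laguerreOffDiag_zero, mul_zero, neg_zero, zero_mul] at h
    exact (mul_eq_zero.mp h).resolve_left (hpos 0)
  | succ m ih =>
    have h := key (m + 1)
    rw [Nat.add_sub_cancel] at h
    have h2 : ((starRingEnd ℂ) (phasedCoeff a k (m + 1) n) * phasedCoeff a k m n).im = 0 := by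
      simp only [Complex.mul_im, Complex.conj_re, Complex.conj_im] at ih ⊢
      linear_combination -ih
    rw [h2, mul_zero] at h
    exact (mul_eq_zero.mp h).resolve_left (hpos (m + 1))

end MatrixElements

/-! ### Completeness and Parseval's identity -/

/-- Parseval's identity for a vector in the closed span of an orthonormal sequence. -/
theorem Orthonormal.hasSum_inner_mul_inner_of_mem_closure {E : Type*} [NormedAddCommGroup E]
    [InnerProductSpace ℂ E] [CompleteSpace E] {e : ℕ → E} (he : Orthonormal ℂ e) (x : E) {y : E}
    (hy : y ∈ (Submodule.span ℂ (Set.range e)).topologicalClosure) :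
    HasSum (fun n => inner ℂ x (e n) * inner ℂ (e n) y) (inner ℂ x y) := by
  obtain ⟨w, b, hw, hb⟩ := he.toSubtypeRange.exists_hilbertBasis_extension
  have h := b.hasSum_inner_mul_inner x y
  have hinj : Function.Injective fun n => (⟨e n, hw ⟨n, rfl⟩⟩ : w) := fun i j hij =>
    he.linearIndependent.injective (congrArg Subtype.val hij)
  rw [← hinj.hasSum_iff] at h
  · simpa [Function.comp_def, hb] using h
  · intro v hv
    have hperp : b v ∈ (Submodule.span ℂ (Set.range e)).topologicalClosureᗮ := by
      rw [Submodule.orthogonal_closure, Submodule.mem_orthogonal]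
      intro u hu
      induction hu using Submodule.span_induction with
      | mem u hu =>
        obtain ⟨n, rfl⟩ := hu
        have hne : (⟨e n, hw ⟨n, rfl⟩⟩ : w) ≠ v := fun hc => hv ⟨n, hc⟩
        simpa [hb] using b.orthonormal.2 hne
      | zero => exact inner_zero_left _
      | add u u' _ _ hu hu' => rw [inner_add_left, hu, hu', add_zero]
      | smul c u _ hu => rw [inner_smul_left, hu, mul_zero]
    rw [Submodule.inner_left_of_mem_orthogonal hy hperp, mul_zero]

section Completeness

open Polynomial

variable {a : ℝ}

theorem eval_map_conj (R : ℂ[X]) (x : ℝ) :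
    (R.map (starRingEnd ℂ)).eval (x : ℂ) = (starRingEnd ℂ) (R.eval (x : ℂ)) := by
  rw [← Complex.conj_ofReal x, eval_map_apply, Complex.conj_ofReal]

theorem norm_eval_sq (R : ℂ[X]) (x : ℝ) :
    ((‖R.eval (x : ℂ)‖ ^ 2 : ℝ) : ℂ) = (R * R.map (starRingEnd ℂ)).eval (x : ℂ) := by
  rw [eval_mul, eval_map_conj, Complex.mul_conj, Complex.normSq_eq_norm_sq]

theorem integrable_norm_eval_sq_mul {b c : ℝ} (ha : 0 ≤ a) (hc : c < 1) (R : ℂ[X])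
    {g : ℝ → ℝ} (hg : Measurable g) (hb : ∀ x, ‖g x‖ ≤ b * Real.exp (c * |x|)) :
    Integrable (fun x : ℝ => ‖R.eval (x : ℂ)‖ ^ 2 * g x) (laguerreMeasure a) := by
  have h := integrable_eval_mul_of_norm_le_exp ha hc (R * R.map (starRingEnd ℂ))
    (g := fun x => (g x : ℂ)) (by fun_prop) (b := b) (by simpa using hb)
  simp only [← norm_eval_sq, ← Complex.ofReal_mul] at h
  exact h.re

/-- The function `x ↦ R(x) e^{ikx}`. -/
noncomputable def expPoly (k : ℝ) (R : ℂ[X]) (x : ℝ) : ℂ :=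
  R.eval (x : ℂ) * Complex.exp (Complex.I * (k : ℂ) * (x : ℂ))

theorem norm_expPoly (k : ℝ) (R : ℂ[X]) (x : ℝ) : ‖expPoly k R x‖ = ‖R.eval (x : ℂ)‖ := by
  rw [expPoly, norm_mul, norm_exp_I_mul, mul_one]

theorem measurable_expPoly (k : ℝ) (R : ℂ[X]) : Measurable (expPoly k R) := by
  have h : Continuous (expPoly k R) := by
    unfold expPoly
    exact (R.continuous.comp Complex.continuous_ofReal).mul (by fun_prop)
  exact h.measurable

theorem memLp_expPoly (ha : 0 ≤ a) (k : ℝ) (R : ℂ[X]) :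
    MemLp (expPoly k R) 2 (laguerreMeasure a) := by
  rw [memLp_two_iff_integrable_sq_norm (measurable_expPoly k R).aestronglyMeasurable]
  simpa [norm_expPoly] using integrable_norm_eval_sq_mul ha zero_lt_one R (g := fun _ => 1)
    measurable_const (b := 1) (by simp)

/-- The function `x ↦ R(x) e^{ikx}` as an element of `L²`, linear in the polynomial `R`. -/
noncomputable def expLp (ha : 0 ≤ a) (k : ℝ) : ℂ[X] →ₗ[ℂ] Lp ℂ 2 (laguerreMeasure a) where
  toFun R := (memLp_expPoly ha k R).toLp _
  map_add' R S := by
    rw [← MemLp.toLp_add]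
    congr 1
    ext x
    simp [expPoly, add_mul]
  map_smul' z R := by
    rw [RingHom.id_apply, ← MemLp.toLp_const_smul]
    congr 1
    ext x
    simp [expPoly, mul_assoc]

theorem expLp_apply (ha : 0 ≤ a) (k : ℝ) (R : ℂ[X]) :
    expLp ha k R = (memLp_expPoly ha k R).toLp _ := rfl

theorem inner_expLp (ha : 0 ≤ a) (k l : ℝ) (R S : ℂ[X]) :
    inner ℂ (expLp ha k R) (expLp ha l S)
      = expMoment a (l - k) (R.map (starRingEnd ℂ) * S) := by
  rw [L2.inner_def, expMoment]
  refine integral_congr_ae ?_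
  filter_upwards [(memLp_expPoly ha k R).coeFn_toLp, (memLp_expPoly ha l S).coeFn_toLp]
    with x h1 h2
  rw [expLp_apply, expLp_apply, h1, h2]
  simp only [expPoly, RCLike.inner_apply, map_mul, eval_mul, eval_map_conj, ← Complex.exp_conj,
    Complex.conj_I, Complex.conj_ofReal]
  rw [show Complex.I * ((l - k : ℝ) : ℂ) * (x : ℂ)
    = Complex.I * l * x + -Complex.I * k * x by push_cast; ring, Complex.exp_add]
  ring

/-- Multiplication by `e^{ikx}` is isometric. -/
theorem dist_expLp_add (ha : 0 ≤ a) (k l : ℝ) (R S : ℂ[X]) :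
    dist (expLp ha (k + l) R) (expLp ha k S) = dist (expLp ha l R) (expLp ha 0 S) := by
  rw [dist_edist, dist_edist]
  simp only [expLp_apply, Lp.edist_toLp_toLp]
  congr 1
  refine eLpNorm_congr_norm_ae (ae_of_all _ fun x => ?_)
  have : (expPoly (k + l) R - expPoly k S) x = Complex.exp (Complex.I * (k : ℂ) * (x : ℂ))
      * (expPoly l R - expPoly 0 S) x := by
    simp only [Pi.sub_apply, expPoly]
    rw [show Complex.I * ((k + l : ℝ) : ℂ) * (x : ℂ)
      = Complex.I * k * x + Complex.I * l * x by push_cast; ring, Complex.exp_add]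
    simp
    ring
  rw [this, norm_mul, norm_exp_I_mul, one_mul]

/-- The Taylor polynomial of `x ↦ e^{ikx}`. -/
noncomputable def expTaylor (k : ℝ) (P : ℕ) : ℂ[X] :=
  ∑ p ∈ Finset.range P, C ((Complex.I * k) ^ p / (p.factorial : ℂ)) * X ^ p

theorem eval_expTaylor (k : ℝ) (P : ℕ) (x : ℝ) : (expTaylor k P).eval (x : ℂ)
    = ∑ p ∈ Finset.range P, (Complex.I * k * x) ^ p / (p.factorial : ℂ) := by
  rw [expTaylor, eval_finsetSum]
  refine Finset.sum_congr rfl fun p _ => ?_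
  simp only [eval_mul, eval_C, eval_pow, eval_X]
  rw [mul_pow (Complex.I * (k : ℂ))]
  ring

theorem tendsto_eval_expTaylor (k x : ℝ) :
    Tendsto (fun P => (expTaylor k P).eval (x : ℂ)) atTop
      (𝓝 (Complex.exp (Complex.I * k * x))) := by
  simp only [eval_expTaylor, Complex.exp_eq_exp_ℂ]
  exact (NormedSpace.expSeries_div_hasSum_exp (Complex.I * k * x : ℂ)).tendsto_sum_nat

theorem norm_eval_expTaylor_le (k : ℝ) (P : ℕ) (x : ℝ) :
    ‖(expTaylor k P).eval (x : ℂ)‖ ≤ Real.exp (|k| * |x|) := by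
  rw [eval_expTaylor]
  refine (norm_sum_le _ _).trans (le_trans (le_of_eq ?_)
    (Real.sum_le_exp_of_nonneg (by positivity) P))
  refine Finset.sum_congr rfl fun p _ => ?_
  simp

theorem norm_toLp_sq {f : ℝ → ℂ} (hf : MemLp f 2 (laguerreMeasure a)) :
    ‖hf.toLp f‖ ^ 2 = ∫ x, ‖f x‖ ^ 2 ∂laguerreMeasure a := by
  rw [← inner_self_eq_norm_sq (𝕜 := ℂ), L2.inner_def, ← integral_re]
  · refine integral_congr_ae ?_
    filter_upwards [hf.coeFn_toLp] with x hx
    rw [hx, inner_self_eq_norm_sq (𝕜 := ℂ)]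
  · exact L2.integrable_inner _ _

theorem tendsto_expLp_taylor (ha : 0 ≤ a) {k : ℝ} (hk : |k| < 1 / 2) (R : ℂ[X]) :
    Tendsto (fun P => expLp ha 0 (R * expTaylor k P)) atTop (𝓝 (expLp ha k R)) := by
  rw [tendsto_iff_norm_sub_tendsto_zero]
  have hsq : Tendsto (fun P => ‖expLp ha 0 (R * expTaylor k P) - expLp ha k R‖ ^ 2) atTop
      (𝓝 0) := by
    have hval : ∀ P x, ‖(expPoly 0 (R * expTaylor k P) - expPoly k R) x‖ ^ 2
        = ‖R.eval (x : ℂ)‖ ^ 2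
          * ‖(expTaylor k P).eval (x : ℂ) - Complex.exp (Complex.I * k * x)‖ ^ 2 := by
      intro P x
      rw [← mul_pow, ← norm_mul]
      congr 2
      simp [expPoly]
      ring
    simp only [expLp_apply, ← MemLp.toLp_sub, norm_toLp_sq, hval]
    have hbound := integrable_norm_eval_sq_mul ha (show 2 * |k| < 1 by linarith) R
      (g := fun x => 4 * Real.exp (2 * |k| * |x|)) (by fun_prop) (b := 4)
      (fun x => by rw [Real.norm_of_nonneg (by positivity)])
    have h0 : (0 : ℝ) = ∫ x, (0 : ℝ) ∂laguerreMeasure a := by simp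
    rw [h0]
    refine tendsto_integral_of_dominated_convergence _ (fun P => ?_) hbound (fun P => ?_) ?_
    · refine Continuous.aestronglyMeasurable ?_
      have h1 := R.continuous.comp Complex.continuous_ofReal
      have h2 := (expTaylor k P).continuous.comp Complex.continuous_ofReal
      simp only [Function.comp_def] at h1 h2
      fun_prop
    · refine ae_of_all _ fun x => ?_
      rw [Real.norm_of_nonneg (by positivity)]
      have h1 : ‖(expTaylor k P).eval (x : ℂ) - Complex.exp (Complex.I * k * x)‖
          ≤ 2 * Real.exp (|k| * |x|) := by
        refine (norm_sub_le _ _).trans ?_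
        rw [norm_exp_I_mul, two_mul]
        exact add_le_add (norm_eval_expTaylor_le k P x) (Real.one_le_exp (by positivity))
      calc _ ≤ ‖R.eval (x : ℂ)‖ ^ 2 * (2 * Real.exp (|k| * |x|)) ^ 2 := by gcongr
        _ = _ := by
          rw [mul_pow, ← Real.exp_nat_mul]
          norm_num
          left
          ring
    · refine ae_of_all _ fun x => ?_
      have h := ((tendsto_eval_expTaylor k x).sub_const
        (Complex.exp (Complex.I * k * x))).norm.pow 2 |>.const_mul (‖R.eval (x : ℂ)‖ ^ 2)
      simpa using h
  have := hsq.sqrt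
  simpa [Real.sqrt_sq (norm_nonneg _)] using this

/-- The functions `R(x) e^{ikx}` lie in the `L²` closure of the polynomials. For `|k| < 1/2` this
is dominated convergence of the Taylor series, and multiplication by `e^{ikx}` being isometric, the
set of admissible `k` is closed under addition. -/
theorem expLp_mem_closure (ha : 0 ≤ a) (k : ℝ) (R : ℂ[X]) :
    expLp ha k R ∈ closure (Set.range (expLp ha 0)) := by
  obtain ⟨M, hM⟩ := exists_nat_gt (2 * |k|)
  have hM0 : (0 : ℝ) < M := lt_of_le_of_lt (by positivity) hM
  have hsmall : ∀ S, expLp ha (k / M) S ∈ closure (Set.range (expLp ha 0)) := by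
    intro S
    refine mem_closure_of_tendsto (tendsto_expLp_taylor ha (k := k / M) ?_ S)
      (Eventually.of_forall fun P => ⟨_, rfl⟩)
    rw [abs_div, abs_of_pos hM0, div_lt_iff₀ hM0]
    linarith
  have hall : ∀ j : ℕ, ∀ S, expLp ha (j * (k / M)) S ∈ closure (Set.range (expLp ha 0)) := by
    intro j
    induction j with
    | zero => intro S; simpa using subset_closure (Set.mem_range_self (f := expLp ha 0) S)
    | succ j ih =>
      intro S
      rw [← closure_closure]
      refine Metric.mem_closure_iff.mpr fun ε hε => ?_
      obtain ⟨_, ⟨T, rfl⟩, hT⟩ := Metric.mem_closure_iff.mp (hsmall S) ε hε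
      refine ⟨_, ih T, ?_⟩
      rw [show ((j + 1 : ℕ) : ℝ) * (k / M) = j * (k / M) + k / M by push_cast; ring,
        dist_expLp_add]
      exact hT
  have := hall M R
  rwa [mul_div_cancel₀ _ hM0.ne'] at this

/-- The orthonormal Laguerre polynomials as elements of `L²`. -/
noncomputable def laguerreLp (ha : 0 ≤ a) (n : ℕ) : Lp ℂ 2 (laguerreMeasure a) :=
  expLp ha 0 (C ((√(laguerreNormSq a n) : ℂ)⁻¹) * monicLaguerre (a : ℂ) n)

theorem inner_expLp_laguerre (ha : 0 ≤ a) (k l : ℝ) (m n : ℕ) :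
    inner ℂ (expLp ha k (C ((√(laguerreNormSq a m) : ℂ)⁻¹) * monicLaguerre (a : ℂ) m))
      (expLp ha l (C ((√(laguerreNormSq a n) : ℂ)⁻¹) * monicLaguerre (a : ℂ) n))
      = laguerreCoeff a (l - k) m n := by
  rw [inner_expLp, Polynomial.map_mul, map_monicLaguerre, map_C, Complex.conj_ofReal, map_inv₀,
    Complex.conj_ofReal, mul_mul_mul_comm, ← C_mul, expMoment_C_mul, laguerreCoeff,
    laguerrePairing]
  push_cast
  rw [div_eq_inv_mul, mul_inv]

theorem orthonormal_laguerreLp (ha : 0 ≤ a) : Orthonormal ℂ (laguerreLp ha) := by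
  rw [orthonormal_iff_ite]
  intro m n
  rw [laguerreLp, laguerreLp, inner_expLp_laguerre, sub_zero, laguerreCoeff_zero ha]

theorem expLp_zero_mem_span (ha : 0 ≤ a) (R : ℂ[X]) :
    expLp ha 0 R ∈ Submodule.span ℂ (Set.range (laguerreLp ha)) := by
  let S : Polynomial.Sequence ℂ := ⟨monicLaguerre (a : ℂ), fun n => by
    have h := monicLaguerre_monic_natDegree (a : ℂ) n
    rw [degree_eq_natDegree h.1.ne_zero, h.2]⟩
  have hS : Submodule.span ℂ (Set.range (monicLaguerre (a : ℂ))) = ⊤ :=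
    S.span fun n => by
      have h := (monicLaguerre_monic_natDegree (a : ℂ) n).1
      change IsUnit (monicLaguerre (a : ℂ) n).leadingCoeff
      rw [h.leadingCoeff]
      exact isUnit_one
  have hR : R ∈ Submodule.span ℂ (Set.range (monicLaguerre (a : ℂ))) := hS ▸ Submodule.mem_top
  induction hR using Submodule.span_induction with
  | mem R hR =>
    obtain ⟨n, rfl⟩ := hR
    have hn : (√(laguerreNormSq a n) : ℂ) ≠ 0 := by
      exact_mod_cast (sqrt_laguerreNormSq_pos ha n).ne'
    have : expLp ha 0 (monicLaguerre (a : ℂ) n)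
        = (√(laguerreNormSq a n) : ℂ) • laguerreLp ha n := by
      rw [laguerreLp, ← map_smul, smul_eq_C_mul, ← mul_assoc, ← C_mul, mul_inv_cancel₀ hn]
      simp
    rw [this]
    exact Submodule.smul_mem _ _ (Submodule.subset_span ⟨n, rfl⟩)
  | zero => rw [map_zero]; exact Submodule.zero_mem _
  | add R R' _ _ h h' => rw [map_add]; exact Submodule.add_mem _ h h'
  | smul c R _ h => rw [map_smul]; exact Submodule.smul_mem _ _ h

/-- The matrix of `e^{ikx}` in the orthonormal Laguerre polynomials has orthonormal rows. -/
theorem hasSum_laguerreCoeff_mul_conj (ha : 0 ≤ a) (k : ℝ) (l m : ℕ) :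
    HasSum (fun n => laguerreCoeff a k l n * (starRingEnd ℂ) (laguerreCoeff a k m n))
      (if l = m then 1 else 0) := by
  have hmem : expLp ha k (C ((√(laguerreNormSq a l) : ℂ)⁻¹) * monicLaguerre (a : ℂ) l)
      ∈ (Submodule.span ℂ (Set.range (laguerreLp ha))).topologicalClosure := by
    refine closure_mono ?_ (expLp_mem_closure ha k _)
    rintro _ ⟨S, rfl⟩
    exact expLp_zero_mem_span ha S
  have h := (orthonormal_laguerreLp ha).hasSum_inner_mul_inner_of_mem_closure
    (expLp ha k (C ((√(laguerreNormSq a m) : ℂ)⁻¹) * monicLaguerre (a : ℂ) m)) hmem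
  rw [inner_expLp_laguerre, sub_self, laguerreCoeff_zero ha] at h
  simp only [eq_comm (a := m)] at h
  convert! h using 2 with n
  rw [laguerreLp, ← inner_conj_symm, inner_expLp_laguerre, inner_expLp_laguerre, sub_zero,
    laguerreCoeff_comm _ _ l, laguerreCoeff_comm _ _ m, mul_comm]

end Completeness

/-! ### The method of moments -/

section MethodOfMoments

theorem hasDerivAt_sum_pow_div_factorial (z : ℂ) (n : ℕ) (s : ℝ) :
    HasDerivAt (fun s : ℝ => ∑ p ∈ Finset.range (n + 1), (z * s) ^ p / (p.factorial : ℂ))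
      (z * ∑ p ∈ Finset.range n, (z * s) ^ p / (p.factorial : ℂ)) s := by
  have hlin : HasDerivAt (fun s : ℝ => z * (s : ℂ)) z s := by
    simpa using ((hasDerivAt_id (s : ℂ)).const_mul z).comp_ofReal
  have h := HasDerivAt.fun_sum (u := Finset.range (n + 1))
    (A := fun (p : ℕ) (s : ℝ) => (z * (s : ℂ)) ^ p / (p.factorial : ℂ))
    (fun p _ => (hlin.fun_pow p).div_const (p.factorial : ℂ))
  convert! h using 1
  rw [Finset.sum_range_succ', Finset.mul_sum]
  simp only [Nat.factorial_zero, Nat.cast_zero, zero_mul, zero_div, add_zero, Nat.add_sub_cancel]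
  refine Finset.sum_congr rfl fun p _ => ?_
  have h1 : ((p : ℂ) + 1) ≠ 0 := by exact_mod_cast p.succ_ne_zero
  have h2 : (p.factorial : ℂ) ≠ 0 := by exact_mod_cast p.factorial_ne_zero
  rw [Nat.factorial_succ]
  push_cast
  field_simp

/-- Taylor remainder of the exponential on the imaginary axis. -/
theorem norm_exp_I_sub_sum_le (y : ℝ) (n : ℕ) :
    ‖Complex.exp (y * Complex.I)
      - ∑ p ∈ Finset.range n, (y * Complex.I) ^ p / (p.factorial : ℂ)‖
      ≤ |y| ^ n / n.factorial := by
  set z : ℂ := y * Complex.I with hz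
  have hznorm : ‖z‖ = |y| := by simp [hz]
  have hexp : ∀ s : ℝ,
      HasDerivAt (fun s : ℝ => Complex.exp (z * s)) (z * Complex.exp (z * s)) s := by
    intro s
    have hlin : HasDerivAt (fun s : ℝ => z * (s : ℂ)) z s := by
      simpa using ((hasDerivAt_id (s : ℂ)).const_mul z).comp_ofReal
    simpa [mul_comm] using hlin.cexp
  have key : ∀ s ∈ Set.Icc (0 : ℝ) 1, ‖Complex.exp (z * s)
      - ∑ p ∈ Finset.range n, (z * s) ^ p / (p.factorial : ℂ)‖ ≤ (|y| * s) ^ n / n.factorial := by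
    induction n with
    | zero =>
      intro s _
      have : z * s = ((y * s : ℝ) : ℂ) * Complex.I := by rw [hz]; push_cast; ring
      rw [this, Finset.range_zero, Finset.sum_empty, sub_zero, Complex.norm_exp_ofReal_mul_I]
      simp
    | succ n ih =>
      have hd : ∀ s : ℝ, HasDerivAt (fun s : ℝ => Complex.exp (z * s)
          - ∑ p ∈ Finset.range (n + 1), (z * s) ^ p / (p.factorial : ℂ))
          (z * (Complex.exp (z * s)
            - ∑ p ∈ Finset.range n, (z * s) ^ p / (p.factorial : ℂ))) s := by
        intro s
        rw [mul_sub]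
        exact (hexp s).sub (hasDerivAt_sum_pow_div_factorial z n s)
      refine image_norm_le_of_norm_deriv_right_le_deriv_boundary
        (fun s _ => (hd s).continuousAt.continuousWithinAt) (fun s _ => (hd s).hasDerivWithinAt)
        (B := fun s => (|y| * s) ^ (n + 1) / (n + 1).factorial)
        (B' := fun s => |y| * ((|y| * s) ^ n / n.factorial)) ?_ ?_ ?_
      · simp [Finset.sum_range_succ']
      · intro s
        have h := ((((hasDerivAt_id s).const_mul |y|).fun_pow (n + 1)).div_const
          ((n + 1).factorial : ℝ))
        convert! h using 1
        have h1 : ((n : ℝ) + 1) ≠ 0 := by positivity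
        have h2 : (n.factorial : ℝ) ≠ 0 := by positivity
        rw [Nat.factorial_succ]
        push_cast
        simp
        field_simp
      · intro s hs
        rw [norm_mul, hznorm]
        exact mul_le_mul_of_nonneg_left (ih s ⟨hs.1, hs.2.le⟩) (abs_nonneg y)
  simpa using key 1 (by simp)

/-- The characteristic function of a measure is approximated by its moments. -/
theorem norm_charFun_sub_sum_moment_le (μ : Measure ℝ) [IsProbabilityMeasure μ]
    (hint : ∀ q : ℕ, Integrable (fun x : ℝ => x ^ q) μ) (t : ℝ) (n : ℕ) :
    ‖charFun μ t - ∑ p ∈ Finset.range (2 * n),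
      (t * Complex.I) ^ p / (p.factorial : ℂ) * ((∫ x, x ^ p ∂μ : ℝ) : ℂ)‖
      ≤ t ^ (2 * n) / (2 * n).factorial * ∫ x, x ^ (2 * n) ∂μ := by
  have hexp : Integrable (fun x : ℝ => Complex.exp (t * x * Complex.I)) μ := by
    refine (integrable_const (1 : ℝ)).mono' (by fun_prop) (ae_of_all _ fun x => ?_)
    rw [show (t : ℂ) * x * Complex.I = ((t * x : ℝ) : ℂ) * Complex.I by push_cast; ring,
      Complex.norm_exp_ofReal_mul_I]
  have hterm : ∀ p ∈ Finset.range (2 * n), Integrable (fun x : ℝ =>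
      (t * Complex.I) ^ p / (p.factorial : ℂ) * ((x ^ p : ℝ) : ℂ)) μ :=
    fun p _ => (hint p).ofReal.const_mul _
  have heq : charFun μ t - ∑ p ∈ Finset.range (2 * n),
      (t * Complex.I) ^ p / (p.factorial : ℂ) * ((∫ x, x ^ p ∂μ : ℝ) : ℂ)
      = ∫ x, (Complex.exp (t * x * Complex.I) - ∑ p ∈ Finset.range (2 * n),
        (t * Complex.I) ^ p / (p.factorial : ℂ) * ((x ^ p : ℝ) : ℂ)) ∂μ := by
    rw [integral_sub hexp (integrable_finsetSum _ hterm), integral_finsetSum _ hterm,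
      charFun_apply_real]
    congr 1
    refine Finset.sum_congr rfl fun p _ => ?_
    rw [integral_const_mul, integral_complex_ofReal]
  rw [heq, ← integral_const_mul]
  refine norm_integral_le_of_norm_le ((hint (2 * n)).const_mul _) (ae_of_all _ fun x => ?_)
  have h := norm_exp_I_sub_sum_le (t * x) (2 * n)
  rw [(even_two_mul n).pow_abs, mul_pow] at h
  convert! h using 1
  · congr 2
    · push_cast; ring_nf
    · refine Finset.sum_congr rfl fun p _ => ?_
      push_cast
      ring
  · ring

/-- Method of moments for a compactly supported limit. -/
theorem tendsto_of_tendsto_moments {μs : ℕ → ProbabilityMeasure ℝ} {μ : ProbabilityMeasure ℝ}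
    {R : ℝ} (hR : ∀ᵐ x ∂(μ : Measure ℝ), |x| ≤ R)
    (hint : ∀ n (q : ℕ), Integrable (fun x : ℝ => x ^ q) (μs n : Measure ℝ))
    (hmom : ∀ q : ℕ, Tendsto (fun n => ∫ x, x ^ q ∂(μs n : Measure ℝ)) atTop
      (𝓝 (∫ x, x ^ q ∂(μ : Measure ℝ)))) :
    Tendsto μs atTop (𝓝 μ) := by
  have hintμ : ∀ q : ℕ, Integrable (fun x : ℝ => x ^ q) (μ : Measure ℝ) := fun q =>
    (integrable_const (R ^ q)).mono' (by fun_prop) (by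
      filter_upwards [hR] with x hx
      rw [norm_pow, Real.norm_eq_abs]
      gcongr)
  refine ProbabilityMeasure.tendsto_of_tendsto_charFun fun t => ?_
  rw [Metric.tendsto_atTop']
  intro ε hε
  have hbd : ∀ n : ℕ, ∫ x, x ^ (2 * n) ∂(μ : Measure ℝ) ≤ R ^ (2 * n) := by
    intro n
    calc ∫ x, x ^ (2 * n) ∂(μ : Measure ℝ) ≤ ∫ _, R ^ (2 * n) ∂(μ : Measure ℝ) := by
          refine integral_mono_ae (hintμ _) (integrable_const _) ?_
          filter_upwards [hR] with x hx
          rw [← (even_two_mul n).pow_abs]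
          gcongr
      _ = R ^ (2 * n) := by simp
  have hfact : Tendsto (fun n : ℕ => (|t| * R) ^ (2 * n) / (2 * n).factorial) atTop (𝓝 0) :=
    (FloorSemiring.tendsto_pow_div_factorial_atTop (|t| * R)).comp
      (tendsto_id.const_mul_atTop' two_pos)
  obtain ⟨n, hn⟩ := ((tendsto_order.1 hfact).2 (ε / 4) (by positivity)).exists
  set c : ℝ := t ^ (2 * n) / (2 * n).factorial with hc
  have hc0 : 0 ≤ c := div_nonneg ((even_two_mul n).pow_nonneg t) (by positivity)
  have hcμ : c * ∫ x, x ^ (2 * n) ∂(μ : Measure ℝ) < ε / 4 := by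
    refine lt_of_le_of_lt (mul_le_mul_of_nonneg_left (hbd n) hc0) ?_
    rw [mul_pow, (even_two_mul n).pow_abs] at hn
    rwa [hc, div_mul_eq_mul_div]
  have hsum : Tendsto (fun N => ∑ p ∈ Finset.range (2 * n), (t * Complex.I) ^ p
      / (p.factorial : ℂ) * ((∫ x, x ^ p ∂(μs N : Measure ℝ) : ℝ) : ℂ)) atTop
      (𝓝 (∑ p ∈ Finset.range (2 * n), (t * Complex.I) ^ p
      / (p.factorial : ℂ) * ((∫ x, x ^ p ∂(μ : Measure ℝ) : ℝ) : ℂ))) :=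
    tendsto_finsetSum _ fun p _ =>
      ((Complex.continuous_ofReal.tendsto _).comp (hmom p)).const_mul _
  have hev1 := Metric.tendsto_atTop'.1 hsum (ε / 4) (by positivity)
  obtain ⟨N1, hN1⟩ := hev1
  obtain ⟨N2, hN2⟩ := eventually_atTop.1
    ((tendsto_order.1 ((hmom (2 * n)).const_mul c)).2 (ε / 4) hcμ)
  refine ⟨max N1 N2, fun N hN => ?_⟩
  have h1 := hN1 N (lt_of_le_of_lt (le_max_left _ _) hN)
  have h2 := hN2 N ((le_max_right _ _).trans hN.le)
  have h3 := norm_charFun_sub_sum_moment_le (μs N : Measure ℝ) (hint N) t n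
  have h4 := norm_charFun_sub_sum_moment_le (μ : Measure ℝ) hintμ t n
  rw [dist_eq_norm] at h1 ⊢
  set A := charFun (μs N : Measure ℝ) t
  set B := charFun (μ : Measure ℝ) t
  set SA := ∑ p ∈ Finset.range (2 * n), (t * Complex.I) ^ p
      / (p.factorial : ℂ) * ((∫ x, x ^ p ∂(μs N : Measure ℝ) : ℝ) : ℂ)
  set SB := ∑ p ∈ Finset.range (2 * n), (t * Complex.I) ^ p
      / (p.factorial : ℂ) * ((∫ x, x ^ p ∂(μ : Measure ℝ) : ℝ) : ℂ)
  calc ‖A - B‖ = ‖(A - SA) + (SA - SB) - (B - SB)‖ := by congr 1; ring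
    _ ≤ ‖A - SA‖ + ‖SA - SB‖ + ‖B - SB‖ :=
      (norm_sub_le _ _).trans (add_le_add_left (norm_add_le _ _) _)
    _ < ε := by linarith

end MethodOfMoments

section DiscreteMeasure

/-- The measure on the line with mass `w n` at `n / N`. -/
noncomputable def scaledMeasure (w : ℕ → ℝ) (N : ℕ) : Measure ℝ :=
  Measure.sum fun n : ℕ => ENNReal.ofReal (w n) • Measure.dirac ((n : ℝ) / N)

variable {w : ℕ → ℝ}

theorem isProbabilityMeasure_scaledMeasure (hw : ∀ n, 0 ≤ w n) (hsum : HasSum w 1) (N : ℕ) :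
    IsProbabilityMeasure (scaledMeasure w N) := by
  refine ⟨?_⟩
  rw [scaledMeasure, Measure.sum_apply _ MeasurableSet.univ]
  simp only [Measure.smul_apply, measure_univ, smul_eq_mul, mul_one]
  rw [← ENNReal.ofReal_tsum_of_nonneg hw hsum.summable, hsum.tsum_eq, ENNReal.ofReal_one]

theorem integrable_scaledMeasure (hw : ∀ n, 0 ≤ w n) (N q : ℕ)
    (h : Summable fun n : ℕ => ((n : ℝ) / N) ^ q * w n) :
    Integrable (fun x : ℝ => x ^ q) (scaledMeasure w N) := by
  refine integrable_sum_dirac (fun _ => ENNReal.ofReal_ne_top) (h.congr fun n => ?_)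
  rw [ENNReal.toReal_ofReal (hw n), Real.norm_of_nonneg (by positivity), mul_comm]

theorem integral_pow_scaledMeasure (hw : ∀ n, 0 ≤ w n) (N q : ℕ) :
    ∫ x, x ^ q ∂scaledMeasure w N = ∑' n : ℕ, ((n : ℝ) / N) ^ q * w n := by
  rw [scaledMeasure, integral_sum_dirac fun _ => ENNReal.ofReal_ne_top]
  refine tsum_congr fun n => ?_
  rw [ENNReal.toReal_ofReal (hw n), smul_eq_mul, mul_comm]

theorem scaledMeasure_real_Iio_one (hw : ∀ n, 0 ≤ w n) {N : ℕ} (hN : 0 < N) :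
    (scaledMeasure w N).real (Set.Iio 1) = ∑ n ∈ Finset.range N, w n := by
  rw [← integral_indicator_one measurableSet_Iio, scaledMeasure,
    integral_sum_dirac fun _ => ENNReal.ofReal_ne_top]
  have hN' : (0 : ℝ) < N := by exact_mod_cast hN
  rw [tsum_eq_sum (s := Finset.range N)]
  · refine Finset.sum_congr rfl fun n hn => ?_
    have : (n : ℝ) / N < 1 := by
      rw [div_lt_one hN']; exact_mod_cast Finset.mem_range.1 hn
    simp [ENNReal.toReal_ofReal (hw n), this]
  · intro n hn
    have : ¬ (n : ℝ) / N < 1 := by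
      rw [div_lt_one hN']
      exact_mod_cast fun h => hn (Finset.mem_range.2 h)
    simp [this]

end DiscreteMeasure

/-! ### Moments of the rows near the edge -/

section RowMoments

variable {a : ℝ}

theorem hasSum_phasedCoeff_mul_conj (ha : 0 ≤ a) (k : ℝ) (l m : ℕ) :
    HasSum (fun n => phasedCoeff a k l n * (starRingEnd ℂ) (phasedCoeff a k m n))
      (if l = m then 1 else 0) := by
  have h := (hasSum_laguerreCoeff_mul_conj ha k l m).mul_left
    (laguerrePhase k ^ l * (starRingEnd ℂ) (laguerrePhase k) ^ m)
  convert! h using 1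
  · ext n
    simp only [phasedCoeff, map_mul, map_pow]
    ring
  · split_ifs with hlm
    · rw [hlm, ← mul_pow, mul_comm (laguerrePhase k), conj_mul_laguerrePhase, one_pow, mul_one]
    · rw [mul_zero]

theorem summable_rowMoment (ha : 0 ≤ a) (k : ℝ) (p l m : ℕ) :
    Summable fun n : ℕ =>
      (n : ℂ) ^ p * (phasedCoeff a k l n * (starRingEnd ℂ) (phasedCoeff a k m n)) := by
  induction p generalizing l with
  | zero => simpa using (hasSum_phasedCoeff_mul_conj ha k l m).summable
  | succ p ih =>
    refine ((((ih l).mul_left ((l + k ^ 2 * (2 * l + a + 1) : ℝ) : ℂ)).add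
      ((ih (l + 1)).mul_left ((k * √(1 + k ^ 2) * laguerreOffDiag a (l + 1) : ℝ) : ℂ))).add
      ((ih (l - 1)).mul_left ((k * √(1 + k ^ 2) * laguerreOffDiag a l : ℝ) : ℂ))).congr
      fun n => ?_
    have h := phasedCoeff_recurrence ha k l n
    linear_combination (-(n : ℂ) ^ p * (starRingEnd ℂ) (phasedCoeff a k m n)) * h

/-- The moment `∑ n^p Ĵ_{l n} conj(Ĵ_{m n})` of a pair of rows of phased matrix elements. -/
noncomputable def rowMoment (a k : ℝ) (p l m : ℕ) : ℂ :=
  ∑' n : ℕ, (n : ℂ) ^ p * (phasedCoeff a k l n * (starRingEnd ℂ) (phasedCoeff a k m n))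

theorem rowMoment_zero (ha : 0 ≤ a) (k : ℝ) (l m : ℕ) :
    rowMoment a k 0 l m = if l = m then 1 else 0 := by
  simpa [rowMoment] using (hasSum_phasedCoeff_mul_conj ha k l m).tsum_eq

theorem rowMoment_succ (ha : 0 ≤ a) (k : ℝ) (p l m : ℕ) :
    rowMoment a k (p + 1) l m
      = ((l + k ^ 2 * (2 * l + a + 1) : ℝ) : ℂ) * rowMoment a k p l m
        + ((k * √(1 + k ^ 2) * laguerreOffDiag a (l + 1) : ℝ) : ℂ) * rowMoment a k p (l + 1) m
        + ((k * √(1 + k ^ 2) * laguerreOffDiag a l : ℝ) : ℂ) * rowMoment a k p (l - 1) m := by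
  have h0 := (summable_rowMoment ha k p l m).hasSum.mul_left
    ((l + k ^ 2 * (2 * l + a + 1) : ℝ) : ℂ)
  have h1 := (summable_rowMoment ha k p (l + 1) m).hasSum.mul_left
    ((k * √(1 + k ^ 2) * laguerreOffDiag a (l + 1) : ℝ) : ℂ)
  have h2 := (summable_rowMoment ha k p (l - 1) m).hasSum.mul_left
    ((k * √(1 + k ^ 2) * laguerreOffDiag a l : ℝ) : ℂ)
  refine HasSum.tsum_eq ?_
  convert! (h0.add h1).add h2 using 1
  ext n
  have h := phasedCoeff_recurrence ha k l n
  linear_combination ((n : ℂ) ^ p * (starRingEnd ℂ) (phasedCoeff a k m n)) * h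

end RowMoments

section CosMoments

/-- The moments of `b + 2 c cos θ` weighted by `cos (l θ)` over a half period: entries of powers of
the Toeplitz matrix with diagonal `b` and off-diagonal `c`. -/
noncomputable def cosMoment (b c : ℝ) (p : ℕ) (l : ℤ) : ℝ :=
  1 / Real.pi * ∫ θ in (0 : ℝ)..Real.pi, (b + 2 * c * Real.cos θ) ^ p * Real.cos (l * θ)

theorem cosMoment_zero (b c : ℝ) (l : ℤ) : cosMoment b c 0 l = if l = 0 then 1 else 0 := by
  unfold cosMoment
  split_ifs with hl
  · simp [hl, Real.pi_ne_zero]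
  · have hl' : (l : ℝ) ≠ 0 := by exact_mod_cast hl
    simp only [pow_zero, one_mul]
    rw [intervalIntegral.integral_comp_mul_left _ hl', integral_cos, mul_zero, Real.sin_zero,
      Real.sin_int_mul_pi]
    simp

theorem cosMoment_succ (b c : ℝ) (p : ℕ) (l : ℤ) :
    cosMoment b c (p + 1) l
      = b * cosMoment b c p l + c * cosMoment b c p (l + 1) + c * cosMoment b c p (l - 1) := by
  have hint : ∀ j : ℤ, IntervalIntegrable
      (fun θ : ℝ => (b + 2 * c * Real.cos θ) ^ p * Real.cos (j * θ)) volume 0 Real.pi :=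
    fun j => Continuous.intervalIntegrable (by fun_prop) _ _
  have hI : ∫ θ in (0 : ℝ)..Real.pi, (b + 2 * c * Real.cos θ) ^ (p + 1) * Real.cos (l * θ)
      = b * (∫ θ in (0 : ℝ)..Real.pi, (b + 2 * c * Real.cos θ) ^ p * Real.cos (l * θ))
      + c * (∫ θ in (0 : ℝ)..Real.pi, (b + 2 * c * Real.cos θ) ^ p * Real.cos ((l + 1 : ℤ) * θ))
      + c * (∫ θ in (0 : ℝ)..Real.pi,
        (b + 2 * c * Real.cos θ) ^ p * Real.cos ((l - 1 : ℤ) * θ)) := by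
    rw [← intervalIntegral.integral_const_mul, ← intervalIntegral.integral_const_mul,
      ← intervalIntegral.integral_const_mul,
      ← intervalIntegral.integral_add ((hint l).const_mul b) ((hint (l + 1)).const_mul c),
      ← intervalIntegral.integral_add
        (((hint l).const_mul b).add ((hint (l + 1)).const_mul c)) ((hint (l - 1)).const_mul c)]
    refine intervalIntegral.integral_congr fun θ _ => ?_
    push_cast
    simp only [add_mul, sub_mul, one_mul, Real.cos_add, Real.cos_sub]
    ring
  rw [cosMoment, hI]
  simp only [cosMoment]
  ring

end CosMoments

section Asymptotics

theorem eventually_toNat_add (i : ℤ) :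
    ∀ᶠ N : ℕ in atTop, 0 < N ∧ (((N + i).toNat : ℕ) : ℝ) = N + i
      ∧ ((N : ℤ) + i).toNat + 1 = ((N : ℤ) + (i + 1)).toNat
      ∧ ((N : ℤ) + i).toNat - 1 = ((N : ℤ) + (i - 1)).toNat := by
  filter_upwards [eventually_ge_atTop (i.natAbs + 2)] with N hN
  refine ⟨by omega, ?_, by omega, by omega⟩
  have h : (((N : ℤ) + i).toNat : ℤ) = N + i := by omega
  exact_mod_cast h

theorem tendsto_toNat_add_div (i : ℤ) :
    Tendsto (fun N : ℕ => ((((N : ℤ) + i).toNat : ℕ) : ℝ) / N) atTop (𝓝 1) := by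
  have h : Tendsto (fun N : ℕ => 1 + (i : ℝ) / N) atTop (𝓝 (1 + 0)) :=
    tendsto_const_nhds.add (tendsto_const_div_atTop_nhds_zero_nat (i : ℝ))
  rw [add_zero] at h
  refine h.congr' ?_
  filter_upwards [eventually_toNat_add i] with N hN
  have : (N : ℝ) ≠ 0 := by exact_mod_cast hN.1.ne'
  rw [hN.2.1]
  field_simp

theorem tendsto_rowMoment_diag (α k : ℝ) (i : ℤ) :
    Tendsto (fun N : ℕ => (((N + i).toNat : ℝ)
      + k ^ 2 * (2 * ((N + i).toNat : ℝ) + α * N + 1)) / N) atTop (𝓝 (1 + k ^ 2 * (2 + α))) := by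
  have h1 := tendsto_toNat_add_div i
  have h2 : Tendsto (fun N : ℕ => (1 : ℝ) / N) atTop (𝓝 0) :=
    tendsto_const_div_atTop_nhds_zero_nat 1
  have h := h1.add (((h1.const_mul 2).add_const α |>.add h2).const_mul (k ^ 2))
  rw [show 1 + k ^ 2 * (2 + α) = 1 + k ^ 2 * (2 * 1 + α + 0) by ring]
  refine h.congr' ?_
  filter_upwards [eventually_gt_atTop 0] with N hN
  have : (N : ℝ) ≠ 0 := by exact_mod_cast hN.ne'
  field_simp

theorem tendsto_laguerreOffDiag_div (α : ℝ) (i : ℤ) :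
    Tendsto (fun N : ℕ => laguerreOffDiag (α * N) (N + i).toNat / N) atTop (𝓝 √(1 + α)) := by
  have h1 := tendsto_toNat_add_div i
  have h := (h1.mul (h1.add_const α)).sqrt
  rw [one_mul] at h
  refine h.congr' ?_
  filter_upwards [eventually_gt_atTop 0] with N hN
  have hN' : (0 : ℝ) < N := by exact_mod_cast hN
  rw [laguerreOffDiag]
  nth_rewrite 4 [← Real.sqrt_sq hN'.le]
  rw [← Real.sqrt_div' _ (by positivity)]
  congr 1
  field_simp

theorem tendsto_rowMoment {α : ℝ} (hα : 0 ≤ α) (k : ℝ) (p : ℕ) (i j : ℤ) :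
    Tendsto (fun N : ℕ => rowMoment (α * N) k p (N + i).toNat (N + j).toNat / (N : ℂ) ^ p) atTop
      (𝓝 (cosMoment (1 + k ^ 2 * (2 + α)) (k * √(1 + k ^ 2) * √(1 + α)) p (i - j) : ℝ)) := by
  induction p generalizing i with
  | zero =>
    rw [cosMoment_zero]
    refine tendsto_const_nhds.congr' ?_
    filter_upwards [eventually_ge_atTop (i.natAbs + j.natAbs)] with N hN
    rw [rowMoment_zero (by positivity), pow_zero, div_one]
    have : i - j = 0 ↔ ((N : ℤ) + i).toNat = ((N : ℤ) + j).toNat := by omega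
    simp only [this]
    split_ifs <;> simp
  | succ p ih =>
    have hB : Tendsto (fun N : ℕ => (((((N + i).toNat : ℝ)
        + k ^ 2 * (2 * ((N + i).toNat : ℝ) + α * N + 1)) / N : ℝ) : ℂ)) atTop _ :=
      (Complex.continuous_ofReal.tendsto _).comp (tendsto_rowMoment_diag α k i)
    have hC : ∀ i : ℤ, Tendsto (fun N : ℕ =>
        ((k * √(1 + k ^ 2) * (laguerreOffDiag (α * N) (N + i).toNat / N) : ℝ) : ℂ)) atTop _ :=
      fun i => (Complex.continuous_ofReal.tendsto _).comp
        ((tendsto_laguerreOffDiag_div α i).const_mul (k * √(1 + k ^ 2)))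
    have h := ((hB.mul (ih i)).add ((hC (i + 1)).mul (ih (i + 1)))).add ((hC i).mul (ih (i - 1)))
    rw [cosMoment_succ, show i - j + 1 = i + 1 - j by ring, show i - j - 1 = i - 1 - j by ring]
    push_cast at h ⊢
    refine h.congr' ?_
    filter_upwards [eventually_toNat_add i] with N hN
    have hN0 : (N : ℂ) ≠ 0 := by exact_mod_cast hN.1.ne'
    rw [rowMoment_succ (by positivity), hN.2.2.1, hN.2.2.2]
    push_cast
    field_simp
    ring

end Asymptotics

/-! ### Weak convergence at the edge -/

section ArcLaw

/-- The law of `b + 2 c cos θ` for `θ ∈ [0, π]` distributed with density `(1 + s cos θ) / π`. -/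
noncomputable def arcLaw (b c s : ℝ) : Measure ℝ :=
  (((volume.restrict (Set.Ioc 0 Real.pi)).withDensity
    fun θ => ENNReal.ofReal ((1 + s * Real.cos θ) / Real.pi))).map fun θ => b + 2 * c * Real.cos θ

variable {b c s : ℝ}

theorem one_add_mul_cos_nonneg (hs : |s| ≤ 1) (θ : ℝ) : 0 ≤ (1 + s * Real.cos θ) / Real.pi := by
  have h : |s * Real.cos θ| ≤ 1 := by
    rw [abs_mul]
    exact mul_le_one₀ hs (abs_nonneg _) (Real.abs_cos_le_one θ)
  have := (abs_le.1 h).1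
  exact div_nonneg (by linarith) Real.pi_pos.le

theorem integral_arcLaw (hs : |s| ≤ 1) {f : ℝ → ℝ} (hf : Measurable f) :
    ∫ x, f x ∂arcLaw b c s = ∫ θ in (0 : ℝ)..Real.pi,
      (1 + s * Real.cos θ) / Real.pi * f (b + 2 * c * Real.cos θ) := by
  rw [arcLaw, integral_map (by fun_prop) hf.aestronglyMeasurable,
    integral_withDensity_eq_integral_toReal_smul (by fun_prop) (by simp),
    intervalIntegral.integral_of_le Real.pi_pos.le]
  simp only [ENNReal.toReal_ofReal (one_add_mul_cos_nonneg hs _), smul_eq_mul]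

theorem isProbabilityMeasure_arcLaw (hs : |s| ≤ 1) : IsProbabilityMeasure (arcLaw b c s) := by
  have h1 : IsFiniteMeasure (arcLaw b c s) := by
    rw [arcLaw]
    have : IsFiniteMeasure ((volume.restrict (Set.Ioc 0 Real.pi)).withDensity
        fun θ => ENNReal.ofReal ((1 + s * Real.cos θ) / Real.pi)) := by
      refine isFiniteMeasure_withDensity_ofReal ?_
      refine Integrable.hasFiniteIntegral ?_
      have : Continuous fun θ : ℝ => (1 + s * Real.cos θ) / Real.pi := by fun_prop
      exact (this.integrableOn_Icc (a := 0) (b := Real.pi)).mono_set Set.Ioc_subset_Icc_self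
    infer_instance
  have h2 := integral_arcLaw (b := b) (c := c) hs (f := fun _ => 1) measurable_const
  have h3 : ∫ θ in (0 : ℝ)..Real.pi, (1 + s * Real.cos θ) / Real.pi * 1 = 1 := by
    simp only [mul_one]
    rw [intervalIntegral.integral_div, intervalIntegral.integral_add (by simp)
      (Continuous.intervalIntegrable (by fun_prop) _ _), intervalIntegral.integral_const_mul,
      integral_cos]
    simp [Real.pi_ne_zero]
  rw [h3] at h2
  refine ⟨?_⟩
  simp only [integral_const, smul_eq_mul, mul_one, Measure.real] at h2
  exact (ENNReal.toReal_eq_one_iff _).1 h2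

theorem ae_arcLaw_abs_le (b c s : ℝ) : ∀ᵐ x ∂arcLaw b c s, |x| ≤ |b| + 2 * |c| := by
  rw [arcLaw, ae_map_iff (by fun_prop) (measurableSet_le (by fun_prop) (by fun_prop))]
  refine ae_of_all _ fun θ => (abs_add_le _ _).trans ?_
  rw [abs_mul, abs_mul, abs_two]
  have := mul_le_mul_of_nonneg_left (Real.abs_cos_le_one θ) (show 0 ≤ 2 * |c| by positivity)
  linarith

theorem integral_pow_arcLaw (hs : |s| ≤ 1) (q : ℕ) :
    ∫ x, x ^ q ∂arcLaw b c s = cosMoment b c q 0 + s * cosMoment b c q 1 := by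
  rw [integral_arcLaw hs (by fun_prop), cosMoment, cosMoment,
    ← intervalIntegral.integral_const_mul, ← intervalIntegral.integral_const_mul,
    ← intervalIntegral.integral_const_mul, ← intervalIntegral.integral_add
      (Continuous.intervalIntegrable (by fun_prop) _ _)
      (Continuous.intervalIntegrable (by fun_prop) _ _)]
  refine intervalIntegral.integral_congr fun θ _ => ?_
  simp
  ring

theorem cos_lt_iff_arccos_lt {y θ : ℝ} (hy : y ≤ 1) (hθ : θ ∈ Set.Icc 0 Real.pi) :
    Real.cos θ < y ↔ Real.arccos y < θ := by
  rcases lt_or_ge y (-1) with h | h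
  · rw [Real.arccos_of_le_neg_one h.le]
    exact ⟨fun h' => absurd (h'.trans h) (Real.neg_one_le_cos θ).not_gt,
      fun h' => absurd h' hθ.2.not_gt⟩
  · conv_lhs => rw [← Real.cos_arccos h hy]
    exact Real.strictAntiOn_cos.lt_iff_gt hθ ⟨Real.arccos_nonneg y, Real.arccos_le_pi y⟩

theorem arcLaw_real_Iio_one (hs : |s| ≤ 1) (hc : 0 < c) (hb : (1 - b) / (2 * c) ≤ 1) :
    (arcLaw b c s).real (Set.Iio 1)
      = (Real.pi - Real.arccos ((1 - b) / (2 * c))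
          - s * Real.sin (Real.arccos ((1 - b) / (2 * c)))) / Real.pi := by
  set y := (1 - b) / (2 * c) with hy
  set t := Real.arccos y with ht
  have hmem : t ∈ Set.Icc 0 Real.pi := ⟨Real.arccos_nonneg y, Real.arccos_le_pi y⟩
  rw [← integral_indicator_one measurableSet_Iio,
    integral_arcLaw hs (f := (Set.Iio (1 : ℝ)).indicator 1)
      (measurable_one.indicator measurableSet_Iio),
    intervalIntegral.integral_of_le Real.pi_pos.le]
  have heq : Set.EqOn (fun θ => (1 + s * Real.cos θ) / Real.pi
        * (Set.Iio (1 : ℝ)).indicator 1 (b + 2 * c * Real.cos θ))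
      ((Set.Ioc t Real.pi).indicator fun θ => (1 + s * Real.cos θ) / Real.pi)
      (Set.Ioc 0 Real.pi) := by
    intro θ hθ
    have hiff : b + 2 * c * Real.cos θ < 1 ↔ t < θ := by
      rw [ht, ← cos_lt_iff_arccos_lt hb ⟨hθ.1.le, hθ.2⟩, lt_div_iff₀ (by positivity)]
      constructor <;> intro h <;> linarith
    by_cases h : t < θ
    · have h' := hiff.2 h
      simp [Set.indicator, h', h, hθ.2]
    · have h' := mt hiff.1 h
      simp only [Set.indicator, Set.mem_Iio, h', Set.mem_Ioc, h, false_and, if_false, mul_zero]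
  rw [setIntegral_congr_fun measurableSet_Ioc heq, setIntegral_indicator measurableSet_Ioc,
    Set.inter_eq_right.2 (Set.Ioc_subset_Ioc_left hmem.1),
    ← intervalIntegral.integral_of_le hmem.2, intervalIntegral.integral_div,
    intervalIntegral.integral_add (by simp)
      (Continuous.intervalIntegrable (by fun_prop) _ _), intervalIntegral.integral_const_mul,
    integral_cos]
  simp
  ring

theorem arcLaw_singleton_one (hc : 0 < c) : arcLaw b c s {1} = 0 := by
  rw [arcLaw, Measure.map_apply (by fun_prop) (measurableSet_singleton 1)]
  refine withDensity_absolutelyContinuous _ _ ?_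
  rw [Measure.restrict_apply (measurableSet_preimage (by fun_prop) (measurableSet_singleton 1))]
  refine Set.Subsingleton.measure_zero (fun θ hθ θ' hθ' => ?_) _
  refine Real.injOn_cos ⟨hθ.2.1.le, hθ.2.2⟩ ⟨hθ'.2.1.le, hθ'.2.2⟩ ?_
  have h1 : b + 2 * c * Real.cos θ = 1 := hθ.1
  have h2 : b + 2 * c * Real.cos θ' = 1 := hθ'.1
  have h3 : 2 * c * (Real.cos θ - Real.cos θ') = 0 := by linear_combination h1 - h2
  exact sub_eq_zero.1 ((mul_eq_zero.1 h3).resolve_left (by positivity))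

end ArcLaw

section EdgeMeasures

/-- The weights obtained from the sum (`s = 1`) or the difference (`s = -1`) of the two rows
adjacent to the edge `N`; for `N ≥ 1` they form a probability distribution in `n`. -/
noncomputable def edgeWeight (a k s : ℝ) (N n : ℕ) : ℝ :=
  ‖phasedCoeff a k N n + s * phasedCoeff a k (N - 1) n‖ ^ 2 / 2

theorem edgeWeight_nonneg (a k s : ℝ) (N n : ℕ) : 0 ≤ edgeWeight a k s N n := by
  unfold edgeWeight; positivity

theorem hasSum_pow_mul_edgeWeight {a s : ℝ} (ha : 0 ≤ a) (hs : s ^ 2 = 1) (k : ℝ) (N q : ℕ) :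
    HasSum (fun n : ℕ => (n : ℝ) ^ q * edgeWeight a k s N n)
      (1 / 2 * (rowMoment a k q N N + s * rowMoment a k q N (N - 1)
        + s * rowMoment a k q (N - 1) N + rowMoment a k q (N - 1) (N - 1)) : ℂ).re := by
  have hS := fun l m => (summable_rowMoment ha k q l m).hasSum
  have h := ((((hS N N).add ((hS N (N - 1)).mul_left (s : ℂ))).add
    ((hS (N - 1) N).mul_left (s : ℂ))).add (hS (N - 1) (N - 1))).mul_left (1 / 2 : ℂ)
  refine (Complex.hasSum_re h).congr_fun fun n => ?_
  have hs' : (s : ℂ) ^ 2 = 1 := by exact_mod_cast hs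
  have key : (((n : ℝ) ^ q * edgeWeight a k s N n : ℝ) : ℂ) = 1 / 2 *
      ((n : ℂ) ^ q * (phasedCoeff a k N n * (starRingEnd ℂ) (phasedCoeff a k N n))
      + s * ((n : ℂ) ^ q * (phasedCoeff a k N n * (starRingEnd ℂ) (phasedCoeff a k (N - 1) n)))
      + s * ((n : ℂ) ^ q * (phasedCoeff a k (N - 1) n * (starRingEnd ℂ) (phasedCoeff a k N n)))
      + (n : ℂ) ^ q
        * (phasedCoeff a k (N - 1) n * (starRingEnd ℂ) (phasedCoeff a k (N - 1) n))) := by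
    rw [edgeWeight, Complex.ofReal_mul, Complex.ofReal_div, Complex.ofReal_pow, Complex.ofReal_pow,
      ← Complex.mul_conj']
    simp only [map_add, map_mul, Complex.conj_ofReal]
    push_cast
    linear_combination (n : ℂ) ^ q * (phasedCoeff a k (N - 1) n
      * (starRingEnd ℂ) (phasedCoeff a k (N - 1) n)) / 2 * hs'
  rw [← key, Complex.ofReal_re]

theorem hasSum_edgeWeight {a s : ℝ} (ha : 0 ≤ a) (hs : s ^ 2 = 1) (k : ℝ) {N : ℕ} (hN : 0 < N) :
    HasSum (edgeWeight a k s N) 1 := by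
  have h := hasSum_pow_mul_edgeWeight ha hs k N 0
  simp only [rowMoment_zero ha, pow_zero, one_mul, if_neg (show N ≠ N - 1 by omega),
    if_neg (show N - 1 ≠ N by omega)] at h
  norm_num at h
  exact h

theorem tendsto_edgeMoment {α s : ℝ} (hα : 0 ≤ α) (k : ℝ) (q : ℕ) :
    Tendsto (fun N : ℕ => (1 / 2 * (rowMoment (α * N) k q N N
      + s * rowMoment (α * N) k q N (N - 1) + s * rowMoment (α * N) k q (N - 1) N
      + rowMoment (α * N) k q (N - 1) (N - 1)) : ℂ).re / (N : ℝ) ^ q) atTop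
      (𝓝 (cosMoment (1 + k ^ 2 * (2 + α)) (k * √(1 + k ^ 2) * √(1 + α)) q 0
        + s * cosMoment (1 + k ^ 2 * (2 + α)) (k * √(1 + k ^ 2) * √(1 + α)) q 1)) := by
  have hR := tendsto_rowMoment hα k q
  have h := (((((hR 0 0).add ((hR 0 (-1)).const_mul (s : ℂ))).add
    ((hR (-1) 0).const_mul (s : ℂ))).add (hR (-1) (-1)))).const_mul (1 / 2 : ℂ)
  have h' := (Complex.continuous_re.tendsto _).comp h
  have hsym : cosMoment (1 + k ^ 2 * (2 + α)) (k * √(1 + k ^ 2) * √(1 + α)) q (-1)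
      = cosMoment (1 + k ^ 2 * (2 + α)) (k * √(1 + k ^ 2) * √(1 + α)) q 1 := by
    simp [cosMoment]
  convert! h' using 1
  · ext N
    have e1 : ((N : ℤ) + -1).toNat = N - 1 := by omega
    have e2 : ((N : ℤ) + 0).toNat = N := by omega
    simp only [Function.comp_apply, e1, e2]
    rw [← Complex.ofReal_natCast, ← Complex.ofReal_pow, ← Complex.div_ofReal_re]
    congr 1
    ring
  · norm_num [hsym]
    ring

/-- The mass below the edge converges to that of the arc law. -/
theorem tendsto_sum_edgeWeight {α s k : ℝ} (hα : 0 ≤ α) (hs : s ^ 2 = 1) (hk : 0 < k) :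
    Tendsto (fun N : ℕ => ∑ n ∈ Finset.range N, edgeWeight (α * N) k s N n) atTop
      (𝓝 ((arcLaw (1 + k ^ 2 * (2 + α)) (k * √(1 + k ^ 2) * √(1 + α)) s).real (Set.Iio 1))) := by
  have hs1 : |s| ≤ 1 := by
    rw [← sq_le_one_iff_abs_le_one, hs]
  have hc : 0 < k * √(1 + k ^ 2) * √(1 + α) := by positivity
  set b := 1 + k ^ 2 * (2 + α)
  set c := k * √(1 + k ^ 2) * √(1 + α)
  have ha : ∀ N : ℕ, 0 ≤ α * N := fun N => by positivity
  have hnn : ∀ N n, 0 ≤ edgeWeight (α * (N : ℕ)) k s N n := fun N n => edgeWeight_nonneg _ _ _ _ _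
  have hprob : ∀ N : ℕ, IsProbabilityMeasure
      (scaledMeasure (edgeWeight (α * (N + 1 : ℕ)) k s (N + 1)) (N + 1)) := fun N =>
    isProbabilityMeasure_scaledMeasure (hnn _) (hasSum_edgeWeight (ha _) hs k N.succ_pos) _
  let μs : ℕ → ProbabilityMeasure ℝ := fun N => ⟨_, hprob N⟩
  let μ : ProbabilityMeasure ℝ := ⟨_, isProbabilityMeasure_arcLaw (b := b) (c := c) hs1⟩
  have hscale : ∀ N q : ℕ, HasSum (fun n : ℕ => ((n : ℝ) / N) ^ q * edgeWeight (α * N) k s N n)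
      ((1 / 2 * (rowMoment (α * N) k q N N
      + s * rowMoment (α * N) k q N (N - 1) + s * rowMoment (α * N) k q (N - 1) N
      + rowMoment (α * N) k q (N - 1) (N - 1)) : ℂ).re / (N : ℝ) ^ q) := by
    intro N q
    refine ((hasSum_pow_mul_edgeWeight (ha N) hs k N q).div_const _).congr_fun fun n => ?_
    rw [div_pow]
    ring
  have hlim : Tendsto μs atTop (𝓝 μ) := by
    refine tendsto_of_tendsto_moments (ae_arcLaw_abs_le b c s) (fun N q => ?_) fun q => ?_
    · exact integrable_scaledMeasure (hnn _) _ _ (hscale (N + 1) q).summable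
    · change Tendsto (fun N => ∫ x, x ^ q ∂scaledMeasure _ _) _ (𝓝 (∫ x, x ^ q ∂arcLaw b c s))
      rw [integral_pow_arcLaw hs1]
      refine ((tendsto_add_atTop_iff_nat 1).2 (tendsto_edgeMoment hα k q)).congr fun N => ?_
      rw [integral_pow_scaledMeasure (hnn _), (hscale (N + 1) q).tsum_eq]
  have hfr : μ (frontier (Set.Iio (1 : ℝ))) = 0 := by
    rw [frontier_Iio]
    exact (ProbabilityMeasure.null_iff_toMeasure_null μ _).2
      (arcLaw_singleton_one (b := b) (s := s) hc)
  have h := ProbabilityMeasure.tendsto_measure_of_null_frontier_of_tendsto hlim hfr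
  have h2 := (NNReal.continuous_coe.tendsto _).comp h
  refine (tendsto_add_atTop_iff_nat 1).1 (h2.congr fun N => ?_)
  exact scaledMeasure_real_Iio_one (hnn _) N.succ_pos

/-- The overlap of the two rows adjacent to the edge, restricted to columns below the edge. -/
theorem tendsto_edge_overlap {α k : ℝ} (hα : 0 ≤ α) (hk : 0 < k) :
    Tendsto (fun N : ℕ => ∑ n ∈ Finset.range N, ((starRingEnd ℂ)
      (phasedCoeff (α * N) k (N - 1) n) * phasedCoeff (α * N) k N n).re) atTop
      (𝓝 (-(Real.sin (Real.arccos (-(k ^ 2 * (2 + α))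
        / (2 * (k * √(1 + k ^ 2) * √(1 + α))))) / Real.pi))) := by
  have hc : 0 < k * √(1 + k ^ 2) * √(1 + α) := by positivity
  have h1 := tendsto_sum_edgeWeight (s := 1) hα (by norm_num) hk
  have h2 := tendsto_sum_edgeWeight (s := -1) hα (by norm_num) hk
  have hle : (1 - (1 + k ^ 2 * (2 + α))) / (2 * (k * √(1 + k ^ 2) * √(1 + α))) ≤ 1 := by
    refine le_trans (div_nonpos_of_nonpos_of_nonneg ?_ (by positivity)) zero_le_one
    have : 0 ≤ k ^ 2 * (2 + α) := by positivity
    linarith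
  rw [arcLaw_real_Iio_one (by norm_num) hc hle] at h1 h2
  have h := (h1.sub h2).div_const 2
  convert! h using 1
  · ext N
    rw [← Finset.sum_sub_distrib, Finset.sum_div]
    refine Finset.sum_congr rfl fun n _ => ?_
    simp only [edgeWeight, ← Complex.normSq_eq_norm_sq, Complex.normSq_apply, Complex.add_re,
      Complex.add_im, Complex.mul_re, Complex.mul_im, Complex.conj_re, Complex.conj_im,
      Complex.ofReal_re, Complex.ofReal_im]
    ring
  · rw [show 1 - (1 + k ^ 2 * (2 + α)) = -(k ^ 2 * (2 + α)) by ring]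
    congr 1
    ring

end EdgeMeasures

/-! ### The current through the edge -/

section Flux

variable {a : ℝ}

/-- The squared Hilbert–Schmidt norm of the `N × N` corner of the matrix of `e^{ikx}`. -/
noncomputable def cornerNormSq (a : ℝ) (N : ℕ) (k : ℝ) : ℝ :=
  ∑ m ∈ Finset.range N, ∑ n ∈ Finset.range N, ‖laguerreCoeff a k m n‖ ^ 2

theorem cornerNormSq_zero (ha : 0 ≤ a) (N : ℕ) : cornerNormSq a N 0 = N := by
  rw [cornerNormSq]
  have h : ∀ m ∈ Finset.range N, ∑ n ∈ Finset.range N, ‖laguerreCoeff a 0 m n‖ ^ 2 = 1 := by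
    intro m hm
    rw [Finset.sum_eq_single_of_mem m hm]
    · simp [laguerreCoeff_zero ha]
    · intro n _ hn
      simp [laguerreCoeff_zero ha, hn.symm]
  rw [Finset.sum_congr rfl h]
  simp

/-- The `k`-derivative of the corner norm telescopes to a current through the edge. -/
theorem hasDerivAt_cornerNormSq (ha : 0 ≤ a) (N : ℕ) (k : ℝ) :
    HasDerivAt (cornerNormSq a N) (-(2 * laguerreOffDiag a N * ∑ n ∈ Finset.range N,
      ((starRingEnd ℂ) (laguerreCoeff a k (N - 1) n) * laguerreCoeff a k N n).im)) k := by
  have hterm : ∀ m n : ℕ, HasDerivAt (fun k => ‖laguerreCoeff a k m n‖ ^ 2)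
      (-2 * (laguerreOffDiag a (n + 1) * ((starRingEnd ℂ) (laguerreCoeff a k m (n + 1 - 1))
          * laguerreCoeff a k m (n + 1)).im
        - laguerreOffDiag a n * ((starRingEnd ℂ) (laguerreCoeff a k m (n - 1))
          * laguerreCoeff a k m n).im)) k := by
    intro m n
    convert! (hasDerivAt_laguerreCoeff ha k m n).norm_sq using 1
    rw [Complex.inner, Nat.add_sub_cancel]
    simp
    ring
  have h := HasDerivAt.fun_sum (u := Finset.range N) fun m _ =>
    HasDerivAt.fun_sum (u := Finset.range N) fun n _ => hterm m n
  refine h.congr_deriv ?_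
  simp only [← Finset.mul_sum]
  have htel := fun m => Finset.sum_range_sub (fun n => laguerreOffDiag a n
    * ((starRingEnd ℂ) (laguerreCoeff a k m (n - 1)) * laguerreCoeff a k m n).im) N
  simp only [htel, laguerreOffDiag_zero, zero_mul, sub_zero]
  rw [← Finset.mul_sum, neg_mul, mul_assoc]
  congr 3
  refine Finset.sum_congr rfl fun m _ => ?_
  rw [laguerreCoeff_comm a k m, laguerreCoeff_comm a k m]

/-- The current through the edge, in terms of phased matrix elements. -/
theorem im_conj_laguerreCoeff_mul (ha : 0 ≤ a) {k : ℝ} (hk : 0 < k) {N : ℕ} (hN : 0 < N) (n : ℕ) :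
    ((starRingEnd ℂ) (laguerreCoeff a k (N - 1) n) * laguerreCoeff a k N n).im
      = -(((starRingEnd ℂ) (phasedCoeff a k (N - 1) n) * phasedCoeff a k N n).re
        / √(1 + k ^ 2)) := by
  obtain ⟨m, rfl⟩ : ∃ m, N = m + 1 := ⟨N - 1, by omega⟩
  rw [Nat.add_sub_cancel]
  have him := im_conj_phasedCoeff_mul_succ ha hk m n
  set Y := (starRingEnd ℂ) (phasedCoeff a k m n) * phasedCoeff a k (m + 1) n with hY
  have hzz := conj_mul_laguerrePhase k
  have hzm : (starRingEnd ℂ) (laguerrePhase k) ^ m * laguerrePhase k ^ m = 1 := by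
    rw [← mul_pow, hzz, one_pow]
  have hJ : (starRingEnd ℂ) (laguerreCoeff a k m n) * laguerreCoeff a k (m + 1) n
      = (starRingEnd ℂ) (laguerrePhase k) * Y := by
    rw [hY, phasedCoeff, phasedCoeff, map_mul, map_pow, pow_succ]
    linear_combination -((starRingEnd ℂ) (laguerreCoeff a k m n) * laguerreCoeff a k (m + 1) n)
      * ((starRingEnd ℂ) (laguerrePhase k) ^ m * laguerrePhase k ^ m * hzz + hzm)
  have hzim : (laguerrePhase k).im = 1 / √(1 + k ^ 2) := by
    rw [laguerrePhase, Complex.div_ofReal_im]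
    simp
  rw [hJ, Complex.mul_im, him, Complex.conj_im, hzim]
  ring

theorem sum_norm_laguerreCoeff_sq_le (ha : 0 ≤ a) (k : ℝ) (m N : ℕ) :
    ∑ n ∈ Finset.range N, ‖laguerreCoeff a k m n‖ ^ 2 ≤ 1 := by
  have h := Complex.hasSum_re (hasSum_laguerreCoeff_mul_conj ha k m m)
  simp only [Complex.mul_conj, Complex.normSq_eq_norm_sq, Complex.ofReal_re, if_true,
    Complex.one_re] at h
  exact sum_le_hasSum _ (fun n _ => by positivity) h

theorem abs_sum_im_conj_laguerreCoeff_le (ha : 0 ≤ a) (k : ℝ) (l m N : ℕ) :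
    |∑ n ∈ Finset.range N,
      ((starRingEnd ℂ) (laguerreCoeff a k l n) * laguerreCoeff a k m n).im| ≤ 1 := by
  refine (Finset.abs_sum_le_sum_abs _ _).trans ?_
  have h1 := sum_norm_laguerreCoeff_sq_le ha k l N
  have h2 := sum_norm_laguerreCoeff_sq_le ha k m N
  calc _ ≤ ∑ n ∈ Finset.range N,
        (‖laguerreCoeff a k l n‖ ^ 2 / 2 + ‖laguerreCoeff a k m n‖ ^ 2 / 2) := by
        refine Finset.sum_le_sum fun n _ => (Complex.abs_im_le_norm _).trans ?_
        rw [norm_mul, Complex.norm_conj]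
        nlinarith [sq_nonneg (‖laguerreCoeff a k l n‖ - ‖laguerreCoeff a k m n‖)]
    _ ≤ 1 := by
        rw [Finset.sum_add_distrib, ← Finset.sum_div, ← Finset.sum_div]
        linarith

theorem continuous_laguerreCoeff (ha : 0 ≤ a) (m n : ℕ) :
    Continuous fun k => laguerreCoeff a k m n :=
  continuous_iff_continuousAt.2 fun k => (hasDerivAt_laguerreCoeff ha k m n).continuousAt

theorem continuous_sum_im_conj_laguerreCoeff (ha : 0 ≤ a) (l m N : ℕ) :
    Continuous fun k => ∑ n ∈ Finset.range N,
      ((starRingEnd ℂ) (laguerreCoeff a k l n) * laguerreCoeff a k m n).im :=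
  continuous_finsetSum _ fun n _ => Complex.continuous_im.comp
    ((Complex.continuous_conj.comp (continuous_laguerreCoeff ha l n)).mul
      (continuous_laguerreCoeff ha m n))

theorem sub_cornerNormSq_eq_integral (ha : 0 ≤ a) (N : ℕ) (k : ℝ) :
    N - cornerNormSq a N k = ∫ t in (0 : ℝ)..k, 2 * laguerreOffDiag a N * ∑ n ∈ Finset.range N,
      ((starRingEnd ℂ) (laguerreCoeff a t (N - 1) n) * laguerreCoeff a t N n).im := by
  have hcont : Continuous fun t => -(2 * laguerreOffDiag a N * ∑ n ∈ Finset.range N,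
      ((starRingEnd ℂ) (laguerreCoeff a t (N - 1) n) * laguerreCoeff a t N n).im) :=
    (continuous_const.mul (continuous_sum_im_conj_laguerreCoeff ha _ _ _)).neg
  have h := intervalIntegral.integral_eq_sub_of_hasDerivAt
    (fun t _ => hasDerivAt_cornerNormSq ha N t) (hcont.intervalIntegrable 0 k)
  rw [intervalIntegral.integral_neg, cornerNormSq_zero ha] at h
  linarith

/-- The limiting rate of growth of the structure function. -/
noncomputable def rampRate (α t : ℝ) : ℝ :=
  (2 + α) / (Real.pi * (1 + t ^ 2)) * √(1 - (α / (2 + α)) ^ 2 * (1 + t ^ 2))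

theorem rampRate_eq {α t : ℝ} (hα : 0 ≤ α) (ht : 0 < t) :
    2 * √(1 + α) * (Real.sin (Real.arccos (-(t ^ 2 * (2 + α))
        / (2 * (t * √(1 + t ^ 2) * √(1 + α))))) / Real.pi / √(1 + t ^ 2)) = rampRate α t := by
  have h1 : 0 < √(1 + t ^ 2) := by positivity
  have h2 : 0 < √(1 + α) := by positivity
  have s1 : √(1 + t ^ 2) ^ 2 = 1 + t ^ 2 := Real.sq_sqrt (by positivity)
  have s2 : √(1 + α) ^ 2 = 1 + α := Real.sq_sqrt (by positivity)
  have key : 1 - (-(t ^ 2 * (2 + α)) / (2 * (t * √(1 + t ^ 2) * √(1 + α)))) ^ 2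
      = (1 - (α / (2 + α)) ^ 2 * (1 + t ^ 2))
        * ((2 + α) / (2 * √(1 + α) * √(1 + t ^ 2))) ^ 2 := by
    rw [div_pow, div_pow, div_pow]
    simp only [mul_pow, s1, s2, neg_sq]
    field_simp
    ring
  rw [Real.sin_arccos, key, Real.sqrt_mul' _ (sq_nonneg _), Real.sqrt_sq (by positivity), rampRate]
  have hpi := Real.pi_pos
  field_simp
  rw [s1]
  ring

theorem laguerreOffDiag_self_div {α : ℝ} (hα : 0 ≤ α) {N : ℕ} (hN : 0 < N) :
    laguerreOffDiag (α * N) N = √(1 + α) * N := by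
  rw [laguerreOffDiag, show (N : ℝ) * (N + α * N) = (1 + α) * (N : ℝ) ^ 2 by ring,
    Real.sqrt_mul (by positivity), Real.sqrt_sq (by positivity)]

/-- The scaled current converges pointwise and is bounded by `2 √(1 + α)`, so it may be integrated
in `k` in the limit. -/
theorem tendsto_sub_cornerNormSq {α : ℝ} (hα : 0 ≤ α) {k : ℝ} (hk : 0 ≤ k) :
    Tendsto (fun N : ℕ => 1 / (N : ℝ) * (N - cornerNormSq (α * N) N k)) atTop
      (𝓝 (∫ t in (0 : ℝ)..k, rampRate α t)) := by
  have ha : ∀ N : ℕ, 0 ≤ α * N := fun N => by positivity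
  have hlim : Tendsto (fun N : ℕ => ∫ t in (0 : ℝ)..k, 2 * √(1 + α) * ∑ n ∈ Finset.range N,
      ((starRingEnd ℂ) (laguerreCoeff (α * N) t (N - 1) n) * laguerreCoeff (α * N) t N n).im) atTop
      (𝓝 (∫ t in (0 : ℝ)..k, rampRate α t)) := by
    refine intervalIntegral.tendsto_integral_filter_of_dominated_convergence
      (fun _ => 2 * √(1 + α) * 1) ?_ ?_ (by simp) ?_
    · exact Eventually.of_forall fun N => (continuous_const.mul
        (continuous_sum_im_conj_laguerreCoeff (ha N) _ _ _)).aestronglyMeasurable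
    · refine Eventually.of_forall fun N => ae_of_all _ fun t _ => ?_
      rw [norm_mul, Real.norm_of_nonneg (by positivity)]
      exact mul_le_mul_of_nonneg_left (abs_sum_im_conj_laguerreCoeff_le (ha N) t _ _ _)
        (by positivity)
    · refine ae_of_all _ fun t ht => ?_
      rw [Set.uIoc_of_le hk] at ht
      have h := ((tendsto_edge_overlap hα ht.1).neg.div_const (√(1 + t ^ 2))).const_mul
        (2 * √(1 + α))
      rw [neg_neg, rampRate_eq hα ht.1] at h
      refine h.congr' ?_
      filter_upwards [eventually_gt_atTop 0] with N hN
      congr 1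
      rw [Finset.sum_congr rfl fun n _ => im_conj_laguerreCoeff_mul (ha N) ht.1 hN n,
        Finset.sum_neg_distrib, ← Finset.sum_div, neg_div]
  refine hlim.congr' ?_
  filter_upwards [eventually_gt_atTop 0] with N hN
  have hN' : (N : ℝ) ≠ 0 := by exact_mod_cast hN.ne'
  rw [sub_cornerNormSq_eq_integral (ha N), ← intervalIntegral.integral_const_mul,
    laguerreOffDiag_self_div hα hN]
  refine intervalIntegral.integral_congr fun t _ => ?_
  field_simp

end Flux

/-! ### Determinantal expansion of the joint density -/

section LUE

open Polynomial

variable {a : ℝ}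

theorem laguerreCoeff_neg (a k : ℝ) (m n : ℕ) :
    laguerreCoeff a (-k) m n = (starRingEnd ℂ) (laguerreCoeff a k m n) := by
  rw [laguerreCoeff, laguerreCoeff, map_div₀, Complex.conj_ofReal, laguerrePairing,
    laguerrePairing, expMoment, expMoment, ← integral_conj]
  congr 2
  ext x
  rw [map_mul, ← eval_map_conj, Polynomial.map_mul, map_monicLaguerre, map_monicLaguerre,
    Complex.conj_ofReal, ← Complex.exp_conj]
  simp

theorem lueUnnormalized_eq_det_sq (N : ℕ) (a : ℝ) (x : Fin N → ℝ) :
    lueUnnormalized N a x = (∏ i, laguerreWeight a (x i))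
      * (Matrix.of fun i j : Fin N => (monicLaguerre a (j : ℕ)).eval (x i)).det ^ 2 := by
  rw [lueUnnormalized, ← Matrix.det_eval_matrixOfPolynomials_eq_det_vandermonde x
    (fun j => monicLaguerre a (j : ℕ)) (fun j => (monicLaguerre_monic_natDegree a j).2)
    (fun j => (monicLaguerre_monic_natDegree a j).1), Matrix.det_vandermonde]
  simp only [sq_abs, Finset.prod_pow]

theorem eval_monicLaguerre_ofReal (a : ℝ) (n : ℕ) (x : ℝ) :
    (monicLaguerre (a : ℂ) n).eval (x : ℂ) = ((monicLaguerre a n).eval x : ℝ) := by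
  have h := map_monicLaguerre a Complex.ofRealHom n
  rw [Complex.ofRealHom_eq_coe] at h
  rw [← h, ← Complex.ofRealHom_eq_coe, eval_map_apply, Complex.ofRealHom_eq_coe]

/-- Expansion of the squared determinant over pairs of permutations. -/
theorem ofReal_lueUnnormalized (N : ℕ) (a : ℝ) (x : Fin N → ℝ) :
    (lueUnnormalized N a x : ℂ) = ∑ σ : Equiv.Perm (Fin N), ∑ τ : Equiv.Perm (Fin N),
      (((Equiv.Perm.sign σ : ℤ) : ℂ) * ((Equiv.Perm.sign τ : ℤ) : ℂ))
        * ∏ i, ((laguerreWeight a (x i) : ℂ) * ((monicLaguerre (a : ℂ) (σ i)).eval (x i : ℂ)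
          * (monicLaguerre (a : ℂ) (τ i)).eval (x i : ℂ))) := by
  rw [lueUnnormalized_eq_det_sq, ← Matrix.det_transpose, sq, Matrix.det_apply']
  push_cast
  rw [Finset.sum_mul_sum, Finset.mul_sum]
  refine Finset.sum_congr rfl fun σ _ => ?_
  rw [Finset.mul_sum]
  refine Finset.sum_congr rfl fun τ _ => ?_
  simp only [Matrix.transpose_apply, Matrix.of_apply, eval_monicLaguerre_ofReal,
    Finset.prod_mul_distrib]
  ring

theorem integrable_weight_mul (ha : 0 ≤ a) (k : ℝ) (m n : ℕ) :
    Integrable fun x : ℝ => Complex.exp (Complex.I * (k : ℂ) * (x : ℂ))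
      * ((laguerreWeight a x : ℂ) * ((monicLaguerre (a : ℂ) m).eval (x : ℂ)
        * (monicLaguerre (a : ℂ) n).eval (x : ℂ))) := by
  have h := (integrable_laguerreMeasure_iff a _).1
    (integrable_expMoment ha k (monicLaguerre (a : ℂ) m * monicLaguerre (a : ℂ) n))
  refine h.congr (ae_of_all _ fun x => ?_)
  simp only [Complex.real_smul, eval_mul]
  ring

theorem integral_weight_mul (a k : ℝ) (m n : ℕ) :
    ∫ x : ℝ, Complex.exp (Complex.I * (k : ℂ) * (x : ℂ))
      * ((laguerreWeight a x : ℂ) * ((monicLaguerre (a : ℂ) m).eval (x : ℂ)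
        * (monicLaguerre (a : ℂ) n).eval (x : ℂ))) = laguerrePairing a k m n := by
  rw [laguerrePairing, expMoment, integral_laguerreMeasure]
  refine integral_congr_ae (ae_of_all _ fun x => ?_)
  simp only [Complex.real_smul, eval_mul]
  ring

theorem exp_mul_lueUnnormalized_eq (N : ℕ) (a : ℝ) (κ x : Fin N → ℝ) :
    (∏ i, Complex.exp (Complex.I * (κ i : ℂ) * (x i : ℂ))) * (lueUnnormalized N a x : ℂ)
      = ∑ σ : Equiv.Perm (Fin N), ∑ τ : Equiv.Perm (Fin N),
      (((Equiv.Perm.sign σ : ℤ) : ℂ) * ((Equiv.Perm.sign τ : ℤ) : ℂ))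
        * ∏ i, (Complex.exp (Complex.I * (κ i : ℂ) * (x i : ℂ)) * ((laguerreWeight a (x i) : ℂ)
          * ((monicLaguerre (a : ℂ) (σ i)).eval (x i : ℂ)
          * (monicLaguerre (a : ℂ) (τ i)).eval (x i : ℂ)))) := by
  rw [ofReal_lueUnnormalized, Finset.mul_sum]
  refine Finset.sum_congr rfl fun σ _ => ?_
  rw [Finset.mul_sum]
  refine Finset.sum_congr rfl fun τ _ => ?_
  simp only [Finset.prod_mul_distrib]
  ring

theorem integrable_perm_term (ha : 0 ≤ a) {N : ℕ} (κ : Fin N → ℝ) (σ τ : Equiv.Perm (Fin N)) :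
    Integrable fun x : Fin N → ℝ => (((Equiv.Perm.sign σ : ℤ) : ℂ)
      * ((Equiv.Perm.sign τ : ℤ) : ℂ))
        * ∏ i, (Complex.exp (Complex.I * (κ i : ℂ) * (x i : ℂ)) * ((laguerreWeight a (x i) : ℂ)
          * ((monicLaguerre (a : ℂ) (σ i)).eval (x i : ℂ)
          * (monicLaguerre (a : ℂ) (τ i)).eval (x i : ℂ)))) :=
  (Integrable.fintype_prod (μ := fun _ : Fin N => (volume : Measure ℝ))
    (f := fun (i : Fin N) (y : ℝ) => Complex.exp (Complex.I * (κ i : ℂ) * (y : ℂ))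
      * ((laguerreWeight a y : ℂ) * ((monicLaguerre (a : ℂ) (σ i)).eval (y : ℂ)
          * (monicLaguerre (a : ℂ) (τ i)).eval (y : ℂ))))
    fun i => integrable_weight_mul ha (κ i) (σ i) (τ i)).const_mul _

theorem integrable_exp_mul_lueUnnormalized (ha : 0 ≤ a) {N : ℕ} (κ : Fin N → ℝ) :
    Integrable fun x : Fin N → ℝ =>
      (∏ i, Complex.exp (Complex.I * (κ i : ℂ) * (x i : ℂ))) * (lueUnnormalized N a x : ℂ) := by
  simp only [exp_mul_lueUnnormalized_eq]
  exact integrable_finsetSum _ fun σ _ => integrable_finsetSum _ fun τ _ =>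
    integrable_perm_term ha κ σ τ

/-- Andréief-type expansion of the exponential moments of the joint density. -/
theorem integral_exp_mul_lueUnnormalized (ha : 0 ≤ a) {N : ℕ} (κ : Fin N → ℝ) :
    ∫ x : Fin N → ℝ,
      (∏ i, Complex.exp (Complex.I * (κ i : ℂ) * (x i : ℂ))) * (lueUnnormalized N a x : ℂ)
      = ((∏ i : Fin N, laguerreNormSq a i : ℝ) : ℂ) * ∑ σ : Equiv.Perm (Fin N),
        ∑ ρ : Equiv.Perm (Fin N), ((Equiv.Perm.sign ρ : ℤ) : ℂ)
          * ∏ i, laguerreCoeff a (κ i) (σ i) (σ (ρ i)) := by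
  simp only [exp_mul_lueUnnormalized_eq]
  rw [integral_finsetSum _ fun σ _ => integrable_finsetSum _ fun τ _ =>
    integrable_perm_term ha κ σ τ, Finset.mul_sum]
  refine Finset.sum_congr rfl fun σ _ => ?_
  rw [integral_finsetSum _ fun τ _ => integrable_perm_term ha κ σ τ, Finset.mul_sum,
    ← Equiv.sum_comp (Equiv.mulLeft σ)]
  refine Finset.sum_congr rfl fun ρ _ => ?_
  rw [integral_const_mul, integral_fintype_prod_volume_eq_prod (f := fun (i : Fin N) (y : ℝ) =>
    Complex.exp (Complex.I * (κ i : ℂ) * (y : ℂ)) * ((laguerreWeight a y : ℂ)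
      * ((monicLaguerre (a : ℂ) (σ i)).eval (y : ℂ)
          * (monicLaguerre (a : ℂ) (Equiv.mulLeft σ ρ i)).eval (y : ℂ))))]
  simp only [integral_weight_mul, laguerrePairing_eq ha, Finset.prod_mul_distrib,
    Equiv.coe_mulLeft, Equiv.Perm.sign_mul, Units.val_mul, Equiv.Perm.coe_mul,
    Function.comp_apply]
  have h1 : ∏ i, (√(laguerreNormSq a (σ i : ℕ)) : ℂ) = ∏ i : Fin N, (√(laguerreNormSq a i) : ℂ) :=
    Equiv.prod_comp σ fun i : Fin N => (√(laguerreNormSq a i) : ℂ)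
  have h2 : ∏ i, (√(laguerreNormSq a (σ (ρ i) : ℕ)) : ℂ)
      = ∏ i : Fin N, (√(laguerreNormSq a i) : ℂ) :=
    Equiv.prod_comp (σ * ρ) fun i : Fin N => (√(laguerreNormSq a i) : ℂ)
  have h3 : (∏ i : Fin N, (√(laguerreNormSq a i) : ℂ)) * ∏ i : Fin N, (√(laguerreNormSq a i) : ℂ)
      = ((∏ i : Fin N, laguerreNormSq a i : ℝ) : ℂ) := by
    rw [← Finset.prod_mul_distrib, Complex.ofReal_prod]
    refine Finset.prod_congr rfl fun i _ => ?_
    rw [← Complex.ofReal_mul, Real.mul_self_sqrt (laguerreNormSq_pos ha _).le]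
  have h4 : ((Equiv.Perm.sign σ : ℤ) : ℂ) * ((Equiv.Perm.sign σ : ℤ) : ℂ) = 1 := by
    rw [← Int.cast_mul, Int.units_coe_mul_self, Int.cast_one]
  rw [h1, h2, h3]
  push_cast
  linear_combination ((Equiv.Perm.sign ρ : ℤ) : ℂ)
    * (∏ i, laguerreCoeff a (κ i) (σ i) (σ (ρ i))) * (∏ i : Fin N, (laguerreNormSq a i : ℂ)) * h4

theorem perm_eq_one_or_swap {ι : Type*} [DecidableEq ι] {j l : ι} {ρ : Equiv.Perm ι}
    (h : ∀ i, i ≠ j → i ≠ l → ρ i = i) : ρ = 1 ∨ ρ = Equiv.swap j l := by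
  have hj : ρ j = j ∨ ρ j = l := by
    by_contra! hc
    exact hc.1 (ρ.injective (h _ hc.1 hc.2))
  have hl : ρ l = j ∨ ρ l = l := by
    by_contra! hc
    exact hc.2 (ρ.injective (h _ hc.1 hc.2))
  rcases hj with hj | hj
  · left
    ext i
    by_cases hij : i = j
    · rw [hij, hj, Equiv.Perm.one_apply]
    by_cases hil : i = l
    · subst hil
      rcases hl with hl | hl
      · exact absurd (ρ.injective (hl.trans hj.symm)) hij
      · rw [hl, Equiv.Perm.one_apply]
    rw [h i hij hil, Equiv.Perm.one_apply]
  · right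
    ext i
    by_cases hij : i = j
    · rw [hij, hj, Equiv.swap_apply_left]
    by_cases hil : i = l
    · subst hil
      rcases hl with hl | hl
      · rw [hl, Equiv.swap_apply_right]
      · exact absurd (ρ.injective (hl.trans hj.symm)) hij
    rw [h i hij hil, Equiv.swap_apply_of_ne_of_ne hij hil]

/-- If `κ` vanishes off `{j, l}`, only the identity and the transposition contribute. -/
theorem sum_sign_mul_prod_of_support (ha : 0 ≤ a) {N : ℕ} {κ : Fin N → ℝ} {j l : Fin N}
    (hjl : j ≠ l) (hκ : ∀ i, i ≠ j → i ≠ l → κ i = 0) (σ : Equiv.Perm (Fin N)) :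
    ∑ ρ : Equiv.Perm (Fin N), ((Equiv.Perm.sign ρ : ℤ) : ℂ)
      * ∏ i, laguerreCoeff a (κ i) (σ i) (σ (ρ i))
      = laguerreCoeff a (κ j) (σ j) (σ j) * laguerreCoeff a (κ l) (σ l) (σ l)
        - laguerreCoeff a (κ j) (σ j) (σ l) * laguerreCoeff a (κ l) (σ l) (σ j) := by
  have hne : (1 : Equiv.Perm (Fin N)) ≠ Equiv.swap j l := fun h => by
    have := congrArg (fun ρ : Equiv.Perm (Fin N) => ρ j) h
    simp only [Equiv.Perm.one_apply, Equiv.swap_apply_left] at this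
    exact hjl this
  rw [Fintype.sum_eq_add (1 : Equiv.Perm (Fin N)) (Equiv.swap j l) hne]
  · rw [Fintype.prod_eq_mul j l hjl, Fintype.prod_eq_mul j l hjl, Equiv.Perm.sign_one,
      Equiv.Perm.sign_swap hjl]
    · simp
      ring
    · rintro i ⟨hj, hl⟩
      rw [Equiv.swap_apply_of_ne_of_ne hj hl, hκ i hj hl, laguerreCoeff_zero ha, if_pos rfl]
    · rintro i ⟨hj, hl⟩
      rw [Equiv.Perm.one_apply, hκ i hj hl, laguerreCoeff_zero ha, if_pos rfl]
  · rintro ρ ⟨h1, h2⟩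
    have : ∃ i, i ≠ j ∧ i ≠ l ∧ ρ i ≠ i := by
      by_contra! hc
      rcases perm_eq_one_or_swap hc with h | h
      · exact h1 h
      · exact h2 h
    obtain ⟨i, hj, hl, hi⟩ := this
    have hσ : ((σ i : Fin N) : ℕ) ≠ (σ (ρ i) : Fin N) := fun h =>
      hi (σ.injective (Fin.ext h)).symm
    rw [Finset.prod_eq_zero (Finset.mem_univ i), mul_zero]
    rw [hκ i hj hl, laguerreCoeff_zero ha, if_neg hσ]

theorem sum_sign_mul_prod_of_support_single (ha : 0 ≤ a) {N : ℕ} {κ : Fin N → ℝ} {j : Fin N}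
    (hκ : ∀ i, i ≠ j → κ i = 0) (σ : Equiv.Perm (Fin N)) :
    ∑ ρ : Equiv.Perm (Fin N), ((Equiv.Perm.sign ρ : ℤ) : ℂ)
      * ∏ i, laguerreCoeff a (κ i) (σ i) (σ (ρ i)) = laguerreCoeff a (κ j) (σ j) (σ j) := by
  rw [Fintype.sum_eq_single (1 : Equiv.Perm (Fin N))]
  · rw [Fintype.prod_eq_single j]
    · simp
    · intro i hj
      rw [Equiv.Perm.one_apply, hκ i hj, laguerreCoeff_zero ha, if_pos rfl]
  · intro ρ h1
    have : ∃ i, i ≠ j ∧ ρ i ≠ i := by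
      by_contra! hc
      rcases perm_eq_one_or_swap (j := j) (l := j) fun i hi _ => hc i hi with h | h
      · exact h1 h
      · exact h1 (h.trans (Equiv.swap_self j))
    obtain ⟨i, hj, hi⟩ := this
    have hσ : ((σ i : Fin N) : ℕ) ≠ (σ (ρ i) : Fin N) := fun h =>
      hi (σ.injective (Fin.ext h)).symm
    rw [Finset.prod_eq_zero (Finset.mem_univ i), mul_zero]
    rw [hκ i hj, laguerreCoeff_zero ha, if_neg hσ]

end LUE

/-! ### The structure function as a corner defect -/

section StructureFunction

variable {a : ℝ}

theorem exp_eq_prod_single {N : ℕ} (k : ℝ) (j : Fin N) (x : Fin N → ℝ) :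
    Complex.exp (Complex.I * (k : ℂ) * (x j : ℂ))
      = ∏ i, Complex.exp (Complex.I * ((Pi.single j k : Fin N → ℝ) i : ℂ) * (x i : ℂ)) := by
  rw [Fintype.prod_eq_single j]
  · rw [Pi.single_eq_same]
  · intro i hi
    rw [Pi.single_eq_of_ne hi]
    simp

theorem integral_lueUnnormalized (ha : 0 ≤ a) {N : ℕ} (hN : 0 < N) :
    (lueNormalization N a : ℂ)
      = ((∏ i : Fin N, laguerreNormSq a i : ℝ) : ℂ) * (N.factorial : ℂ) := by
  have h := integral_exp_mul_lueUnnormalized ha (N := N) (fun _ => 0)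
  have hone : ∀ σ : Equiv.Perm (Fin N), ∑ ρ : Equiv.Perm (Fin N), ((Equiv.Perm.sign ρ : ℤ) : ℂ)
      * ∏ i, laguerreCoeff a 0 (σ i) (σ (ρ i)) = 1 := fun σ =>
    (sum_sign_mul_prod_of_support_single ha (κ := fun _ : Fin N => (0 : ℝ))
      (j := ⟨0, hN⟩) (fun _ _ => rfl) σ).trans (by rw [laguerreCoeff_zero ha, if_pos rfl])
  simp only [hone] at h
  rw [lueNormalization, ← integral_complex_ofReal]
  simpa [Fintype.card_perm] using h

theorem lueNormalization_ne_zero (ha : 0 ≤ a) {N : ℕ} (hN : 0 < N) :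
    (lueNormalization N a : ℂ) ≠ 0 := by
  rw [integral_lueUnnormalized ha hN]
  refine mul_ne_zero ?_ (by exact_mod_cast N.factorial_ne_zero)
  exact_mod_cast (Finset.prod_pos fun i _ => laguerreNormSq_pos ha _).ne'

/-- Mean of the linear statistic. -/
theorem integral_fourierStatistic (ha : 0 ≤ a) {N : ℕ} (hN : 0 < N) (k : ℝ) :
    ∫ x : Fin N → ℝ, fourierStatistic N k x * (luePDF N a x : ℂ)
      = ∑ j : Fin N, laguerreCoeff a k j j := by
  have hC := lueNormalization_ne_zero ha hN
  have hint := fun j : Fin N => integrable_exp_mul_lueUnnormalized ha (Pi.single j k : Fin N → ℝ)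
  have heq : ∀ x : Fin N → ℝ, fourierStatistic N k x * (luePDF N a x : ℂ)
      = (∑ j : Fin N, (∏ i, Complex.exp (Complex.I * ((Pi.single j k : Fin N → ℝ) i : ℂ)
        * (x i : ℂ))) * (lueUnnormalized N a x : ℂ)) / (lueNormalization N a : ℂ) := by
    intro x
    rw [fourierStatistic, luePDF, ← Finset.sum_mul, Complex.ofReal_div, mul_div_assoc]
    simp only [← exp_eq_prod_single]
  simp only [heq]
  rw [integral_div, integral_finsetSum _ fun j _ => hint j, div_eq_iff hC,
    integral_lueUnnormalized ha hN]
  have hterm : ∀ j : Fin N, ∀ σ : Equiv.Perm (Fin N),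
      ∑ ρ : Equiv.Perm (Fin N), ((Equiv.Perm.sign ρ : ℤ) : ℂ)
        * ∏ i, laguerreCoeff a ((Pi.single j k : Fin N → ℝ) i) (σ i) (σ (ρ i))
      = laguerreCoeff a k (σ j) (σ j) := by
    intro j σ
    rw [sum_sign_mul_prod_of_support_single ha (κ := Pi.single j k) (j := j)
      (fun i hi => Pi.single_eq_of_ne (M := fun _ => ℝ) hi k) σ, Pi.single_eq_same]
  simp only [integral_exp_mul_lueUnnormalized ha, hterm]
  rw [← Finset.mul_sum, Finset.sum_comm]
  have hσ : ∀ σ : Equiv.Perm (Fin N), ∑ j : Fin N, laguerreCoeff a k (σ j) (σ j)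
      = ∑ j : Fin N, laguerreCoeff a k j j := fun σ =>
    Equiv.sum_comp σ fun j : Fin N => laguerreCoeff a k j j
  simp only [hσ, Finset.sum_const, Finset.card_univ, Fintype.card_perm, Fintype.card_fin,
    nsmul_eq_mul]
  ring

/-- Second absolute moment of the linear statistic. -/
theorem integral_norm_fourierStatistic_sq (ha : 0 ≤ a) {N : ℕ} (hN : 0 < N) (k : ℝ) :
    ((∫ x : Fin N → ℝ, ‖fourierStatistic N k x‖ ^ 2 * luePDF N a x : ℝ) : ℂ)
      = N + ∑ j : Fin N, ∑ l : Fin N,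
        (laguerreCoeff a k j j * (starRingEnd ℂ) (laguerreCoeff a k l l)
          - laguerreCoeff a k j l * (starRingEnd ℂ) (laguerreCoeff a k j l)) := by
  have hC := lueNormalization_ne_zero ha hN
  set κ : Fin N → Fin N → Fin N → ℝ := fun j l => Pi.single j k + Pi.single l (-k) with hκ
  have hint := fun j l : Fin N => integrable_exp_mul_lueUnnormalized ha (κ j l)
  have heq : ∀ x : Fin N → ℝ, ((‖fourierStatistic N k x‖ ^ 2 * luePDF N a x : ℝ) : ℂ)
      = (∑ j : Fin N, ∑ l : Fin N, (∏ i, Complex.exp (Complex.I * (κ j l i : ℂ)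
        * (x i : ℂ))) * (lueUnnormalized N a x : ℂ)) / (lueNormalization N a : ℂ) := by
    intro x
    have hconj : ∀ l : Fin N, (starRingEnd ℂ) (Complex.exp (Complex.I * (k : ℂ) * (x l : ℂ)))
        = Complex.exp (Complex.I * ((-k : ℝ) : ℂ) * (x l : ℂ)) := by
      intro l
      rw [← Complex.exp_conj]
      simp
    have hprod : ∀ j l : Fin N, ∏ i, Complex.exp (Complex.I * (κ j l i : ℂ) * (x i : ℂ))
        = Complex.exp (Complex.I * (k : ℂ) * (x j : ℂ))
          * (starRingEnd ℂ) (Complex.exp (Complex.I * (k : ℂ) * (x l : ℂ))) := by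
      intro j l
      rw [hconj, exp_eq_prod_single k j x, exp_eq_prod_single (-k) l x, ← Finset.prod_mul_distrib]
      refine Finset.prod_congr rfl fun i _ => ?_
      rw [← Complex.exp_add, hκ]
      congr 1
      simp only [Pi.add_apply]
      push_cast
      ring
    rw [Complex.ofReal_mul, Complex.ofReal_pow, ← Complex.mul_conj', fourierStatistic, luePDF,
      map_sum, Finset.sum_mul_sum, Complex.ofReal_div, ← mul_div_assoc]
    simp only [hprod, Finset.sum_mul]
  rw [← integral_complex_ofReal]
  simp only [heq]
  rw [integral_div, integral_finsetSum _ fun j _ => integrable_finsetSum _ fun l _ => hint j l,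
    div_eq_iff hC, integral_lueUnnormalized ha hN]
  -- On the diagonal `j = l` the frequencies cancel; the bracket vanishes there.
  have hterm : ∀ j l : Fin N, ∀ σ : Equiv.Perm (Fin N),
      ∑ ρ : Equiv.Perm (Fin N), ((Equiv.Perm.sign ρ : ℤ) : ℂ)
        * ∏ i, laguerreCoeff a (κ j l i) (σ i) (σ (ρ i))
      = (if j = l then 1 else 0)
        + (laguerreCoeff a k (σ j) (σ j) * (starRingEnd ℂ) (laguerreCoeff a k (σ l) (σ l))
          - laguerreCoeff a k (σ j) (σ l)
            * (starRingEnd ℂ) (laguerreCoeff a k (σ j) (σ l))) := by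
    intro j l σ
    by_cases hjl : j = l
    · subst hjl
      have h0 : ∀ i, κ j j i = 0 := by
        intro i
        by_cases hi : i = j
        · subst hi; simp [hκ]
        · simp [hκ, hi]
      rw [sum_sign_mul_prod_of_support_single ha (κ := κ j j) (j := j) (fun i _ => h0 i) σ, h0,
        laguerreCoeff_zero ha]
      simp
    · rw [sum_sign_mul_prod_of_support ha hjl (fun i hj hl => by simp [hκ, hj, hl]) σ, if_neg hjl,
        zero_add]
      have h1 : κ j l j = k := by simp [hκ, hjl]
      have h2 : κ j l l = -k := by simp [hκ, Ne.symm hjl]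
      rw [h1, h2, laguerreCoeff_neg, laguerreCoeff_neg, laguerreCoeff_comm a k (σ l) (σ j)]
  have hswap : ∀ j : Fin N, ∫ x : Fin N → ℝ, ∑ l : Fin N,
      (∏ i, Complex.exp (Complex.I * (κ j l i : ℂ) * (x i : ℂ))) * (lueUnnormalized N a x : ℂ)
      = ∑ l : Fin N, ∫ x : Fin N → ℝ,
      (∏ i, Complex.exp (Complex.I * (κ j l i : ℂ) * (x i : ℂ)))
        * (lueUnnormalized N a x : ℂ) :=
    fun j => integral_finsetSum _ fun l _ => hint j l
  simp only [hswap, integral_exp_mul_lueUnnormalized ha, hterm, ← Finset.mul_sum]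
  rw [mul_comm _ (_ * _), mul_assoc]
  congr 1
  have hσ : ∀ σ : Equiv.Perm (Fin N), ∑ j : Fin N, ∑ l : Fin N, ((if j = l then 1 else 0)
        + (laguerreCoeff a k (σ j) (σ j) * (starRingEnd ℂ) (laguerreCoeff a k (σ l) (σ l))
          - laguerreCoeff a k (σ j) (σ l) * (starRingEnd ℂ) (laguerreCoeff a k (σ j) (σ l))))
      = N + ∑ j : Fin N, ∑ l : Fin N,
        (laguerreCoeff a k j j * (starRingEnd ℂ) (laguerreCoeff a k l l)
          - laguerreCoeff a k j l * (starRingEnd ℂ) (laguerreCoeff a k j l)) := by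
    intro σ
    simp only [Finset.sum_add_distrib]
    congr 1
    · simp
    · rw [← Equiv.sum_comp σ fun j : Fin N => ∑ l : Fin N,
        (laguerreCoeff a k j j * (starRingEnd ℂ) (laguerreCoeff a k l l)
          - laguerreCoeff a k j l * (starRingEnd ℂ) (laguerreCoeff a k j l))]
      refine Finset.sum_congr rfl fun j _ => ?_
      exact Equiv.sum_comp σ fun l : Fin N =>
        (laguerreCoeff a k (σ j) (σ j) * (starRingEnd ℂ) (laguerreCoeff a k l l)
          - laguerreCoeff a k (σ j) l * (starRingEnd ℂ) (laguerreCoeff a k (σ j) l))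
  have hcomm : ∑ j : Fin N, ∑ l : Fin N, ∑ σ : Equiv.Perm (Fin N), ((if j = l then 1 else 0)
        + (laguerreCoeff a k (σ j) (σ j) * (starRingEnd ℂ) (laguerreCoeff a k (σ l) (σ l))
          - laguerreCoeff a k (σ j) (σ l) * (starRingEnd ℂ) (laguerreCoeff a k (σ j) (σ l))))
      = ∑ σ : Equiv.Perm (Fin N), ∑ j : Fin N, ∑ l : Fin N, ((if j = l then 1 else 0)
        + (laguerreCoeff a k (σ j) (σ j) * (starRingEnd ℂ) (laguerreCoeff a k (σ l) (σ l))
          - laguerreCoeff a k (σ j) (σ l)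
            * (starRingEnd ℂ) (laguerreCoeff a k (σ j) (σ l)))) := by
    rw [Finset.sum_comm]
    rw [Finset.sum_congr rfl fun _ _ => Finset.sum_comm, Finset.sum_comm]
    exact Finset.sum_congr rfl fun σ _ => Finset.sum_comm
  rw [hcomm, Finset.sum_congr rfl fun σ _ => hσ σ, Finset.sum_const, Finset.card_univ,
    Fintype.card_perm, Fintype.card_fin, nsmul_eq_mul]

/-- The structure function is the defect of the `N × N` corner of the unitary matrix of `e^{ikx}`
from being unitary. -/
theorem lueStructureFunction_eq (ha : 0 ≤ a) {N : ℕ} (hN : 0 < N) (k : ℝ) :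
    lueStructureFunction N a k = N - cornerNormSq a N k := by
  have h2 := integral_norm_fourierStatistic_sq ha hN k
  have h1 := integral_fourierStatistic ha hN k
  rw [lueStructureFunction, h1]
  have hsq : ((‖∑ j : Fin N, laguerreCoeff a k j j‖ ^ 2 : ℝ) : ℂ)
      = ∑ j : Fin N, ∑ l : Fin N,
        laguerreCoeff a k j j * (starRingEnd ℂ) (laguerreCoeff a k l l) := by
    rw [Complex.ofReal_pow, ← Complex.mul_conj', map_sum, Finset.sum_mul_sum]
  have hcorner : ((cornerNormSq a N k : ℝ) : ℂ) = ∑ j : Fin N, ∑ l : Fin N,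
      laguerreCoeff a k j l * (starRingEnd ℂ) (laguerreCoeff a k j l) := by
    rw [cornerNormSq, Finset.sum_range, Complex.ofReal_sum]
    refine Finset.sum_congr rfl fun j _ => ?_
    rw [Finset.sum_range, Complex.ofReal_sum]
    refine Finset.sum_congr rfl fun l _ => ?_
    rw [Complex.ofReal_pow, Complex.mul_conj']
  apply Complex.ofReal_injective
  rw [Complex.ofReal_sub, Complex.ofReal_sub, h2, hsq, hcorner]
  simp only [Finset.sum_sub_distrib]
  push_cast
  ring

end StructureFunction

/-! ### Wachter's density and the ramp -/

section WachterIntegral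

theorem sqrt_wachter_param {α : ℝ} (hα : 0 ≤ α) : √((α / (2 + α)) ^ 2) = α / (2 + α) :=
  Real.sqrt_sq (by positivity)

theorem wachter_param_lt_one {α : ℝ} (hα : 0 ≤ α) : (α / (2 + α)) ^ 2 < 1 := by
  have h : α / (2 + α) < 1 := by rw [div_lt_one (by linarith)]; linarith
  have h0 : 0 ≤ α / (2 + α) := by positivity
  nlinarith

theorem image_one_div_one_add_sq_Ioo {k : ℝ} (hk : 0 ≤ k) :
    (fun t : ℝ => 1 / (1 + t ^ 2)) '' Set.Ioo 0 k = Set.Ioo (1 / (1 + k ^ 2)) 1 := by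
  ext y
  constructor
  · rintro ⟨t, ⟨h0, hk'⟩, rfl⟩
    refine ⟨one_div_lt_one_div_of_lt (by positivity) (by nlinarith), ?_⟩
    rw [div_lt_one (by positivity)]
    nlinarith
  · rintro ⟨h1, h2⟩
    have hy : 0 < y := lt_trans (by positivity) h1
    have h3 : 1 < 1 / y := by rwa [lt_div_iff₀ hy, one_mul]
    have h4 : 1 / y < 1 + k ^ 2 := by
      rw [div_lt_iff₀ hy]
      rw [div_lt_iff₀ (by positivity)] at h1
      linarith
    refine ⟨√(1 / y - 1), ⟨Real.sqrt_pos.2 (by linarith), ?_⟩, ?_⟩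
    · rw [Real.sqrt_lt' (lt_of_le_of_ne hk ?_)]
      · linarith
      · rintro rfl
        norm_num at h4
        linarith
    · dsimp only
      rw [Real.sq_sqrt (by linarith)]
      field_simp
      ring

theorem injOn_one_div_one_add_sq (k : ℝ) :
    Set.InjOn (fun t : ℝ => 1 / (1 + t ^ 2)) (Set.Ioo 0 k) := by
  intro s hs t ht h
  have h' : 1 + s ^ 2 = 1 + t ^ 2 := by
    have := congrArg (fun y => 1 / y) h
    simpa using this
  exact (sq_eq_sq₀ hs.1.le ht.1.le).1 (by linarith)

theorem hasDerivAt_one_div_one_add_sq (t : ℝ) :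
    HasDerivAt (fun t : ℝ => 1 / (1 + t ^ 2)) (-(2 * t) / (1 + t ^ 2) ^ 2) t := by
  have h : HasDerivAt (fun t : ℝ => 1 + t ^ 2) (2 * t) t := by
    simpa using (hasDerivAt_pow 2 t).const_add 1
  simpa [one_div] using h.fun_inv (by positivity : (1 + t ^ 2 : ℝ) ≠ 0)

/-- The substitution `x = 1 / (1 + t ^ 2)` turns Wachter's density into the ramp rate. -/
theorem abs_deriv_mul_wachterDensity {α t : ℝ} (hα : 0 ≤ α) (ht : 0 < t) :
    |-(2 * t) / (1 + t ^ 2) ^ 2| • wachterDensity ((α / (2 + α)) ^ 2) (1 / (1 + t ^ 2))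
      = rampRate α t := by
  have h1 : 1 / (1 + t ^ 2) < 1 := by
    rw [div_lt_one (by positivity)]; nlinarith
  have hpi := Real.pi_pos
  rw [wachterDensity, rampRate, smul_eq_mul]
  set c := (α / (2 + α)) ^ 2 with hc
  split_ifs with h
  · have hE : 0 ≤ 1 - c * (1 + t ^ 2) := by
      have := h.1
      rw [lt_div_iff₀ (by positivity)] at this
      linarith
    have hs : √((1 / (1 + t ^ 2) - c) / (1 - 1 / (1 + t ^ 2))) = √(1 - c * (1 + t ^ 2)) / t := by
      have : (1 / (1 + t ^ 2) - c) / (1 - 1 / (1 + t ^ 2)) = (1 - c * (1 + t ^ 2)) / t ^ 2 := by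
        have : 1 - 1 / (1 + t ^ 2) = t ^ 2 / (1 + t ^ 2) := by field_simp; ring
        rw [this]
        field_simp
      rw [this, Real.sqrt_div hE, Real.sqrt_sq ht.le]
    have h2 : 1 - α / (2 + α) = 2 / (2 + α) := by field_simp; ring
    rw [hs, abs_div, abs_neg, abs_of_pos (by positivity : 0 < 2 * t),
      abs_of_pos (by positivity : 0 < (1 + t ^ 2) ^ 2), sqrt_wachter_param hα, h2]
    field_simp
  · have hE : 1 - c * (1 + t ^ 2) ≤ 0 := by
      by_contra! hE
      refine h ⟨?_, h1⟩
      rw [lt_div_iff₀ (by positivity)]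
      linarith
    rw [Real.sqrt_eq_zero_of_nonpos hE, mul_zero, mul_zero]

theorem continuous_rampRate (α : ℝ) : Continuous (rampRate α) := by
  unfold rampRate
  refine Continuous.mul (Continuous.div (by fun_prop) (by fun_prop) fun t => ?_) (by fun_prop)
  have := Real.pi_pos
  positivity

theorem intervalIntegrable_wachterDensity {α k : ℝ} (hα : 0 ≤ α) (hk : 0 ≤ k) :
    IntervalIntegrable (wachterDensity ((α / (2 + α)) ^ 2)) volume (1 / (1 + k ^ 2)) 1 := by
  have hd : 1 / (1 + k ^ 2) ≤ 1 := by rw [div_le_one (by positivity)]; nlinarith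
  rw [intervalIntegrable_iff_integrableOn_Ioo_of_le hd, ← image_one_div_one_add_sq_Ioo hk,
    integrableOn_image_iff_integrableOn_abs_deriv_smul measurableSet_Ioo
      (fun t _ => (hasDerivAt_one_div_one_add_sq t).hasDerivWithinAt) (injOn_one_div_one_add_sq k)]
  refine (((continuous_rampRate α).integrableOn_Icc (a := 0) (b := k)).mono_set
    Set.Ioo_subset_Icc_self).congr_fun (fun t ht => ?_) measurableSet_Ioo
  exact (abs_deriv_mul_wachterDensity hα ht.1).symm

theorem integral_wachterDensity {α k : ℝ} (hα : 0 ≤ α) (hk : 0 ≤ k) :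
    ∫ x in (1 / (1 + k ^ 2))..1, wachterDensity ((α / (2 + α)) ^ 2) x
      = ∫ t in (0 : ℝ)..k, rampRate α t := by
  have hd : 1 / (1 + k ^ 2) ≤ 1 := by rw [div_le_one (by positivity)]; nlinarith
  rw [intervalIntegral.integral_of_le hd, intervalIntegral.integral_of_le hk,
    integral_Ioc_eq_integral_Ioo, integral_Ioc_eq_integral_Ioo, ← image_one_div_one_add_sq_Ioo hk,
    integral_image_eq_integral_abs_deriv_smul measurableSet_Ioo
      (fun t _ => (hasDerivAt_one_div_one_add_sq t).hasDerivWithinAt) (injOn_one_div_one_add_sq k)]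
  exact setIntegral_congr_fun measurableSet_Ioo fun t ht =>
    abs_deriv_mul_wachterDensity hα ht.1

end WachterIntegral

section Ramp

/-- The reading of `Arctan √(p / q)` at `q = 0` agrees with a formula continuous there. -/
theorem arctanSqrtRatio_eq_arcsin {p q : ℝ} (hp : 0 ≤ p) (hq : 0 ≤ q) (hpq : 0 < p + q) :
    arctanSqrtRatio p q = Real.arcsin √(p / (p + q)) := by
  unfold arctanSqrtRatio
  split_ifs with h
  · subst h
    rw [add_zero] at hpq ⊢
    rw [div_self hpq.ne', Real.sqrt_one, Real.arcsin_one]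
  · have hq' : 0 < q := lt_of_le_of_ne hq (Ne.symm h)
    rw [Real.arctan_eq_arcsin, Real.sq_sqrt (by positivity), ← Real.sqrt_div (by positivity)]
    congr 2
    field_simp
    ring

/-- The antiderivative of the ramp rate, in terms of arcsines. -/
noncomputable def rampPrimitive (c t : ℝ) : ℝ :=
  2 / (Real.pi * (1 - √c)) *
    (-√c * Real.arcsin (t * √(c / (1 - c))) + Real.arcsin (t / √(1 + t ^ 2) / √(1 - c)))

theorem rampPrimitive_eq {c k : ℝ} (hc0 : 0 ≤ c) (hc1 : c < 1) (hk : 0 ≤ k)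
    (hck : c * (1 + k ^ 2) ≤ 1) : rampPrimitive c k = rampExpression c (1 / (1 + k ^ 2)) := by
  have hc' : 0 < 1 - c := by linarith
  have hd1 : 1 - 1 / (1 + k ^ 2) = k ^ 2 / (1 + k ^ 2) := by field_simp; ring
  have hsum : c * (1 - 1 / (1 + k ^ 2)) + (1 / (1 + k ^ 2) - c) = (1 - c) / (1 + k ^ 2) := by
    field_simp; ring
  have hq : 0 ≤ 1 / (1 + k ^ 2) - c := by
    rw [sub_nonneg, le_div_iff₀ (by positivity)]; exact hck
  rw [rampPrimitive, rampExpression, arctanSqrtRatio_eq_arcsin (by rw [hd1]; positivity) hq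
    (by rw [hsum]; positivity), hsum, hd1]
  have e1 : c * (k ^ 2 / (1 + k ^ 2)) / ((1 - c) / (1 + k ^ 2)) = k ^ 2 * (c / (1 - c)) := by
    field_simp
  rw [e1, Real.sqrt_mul (by positivity), Real.sqrt_sq hk,
    Real.sqrt_div (by positivity : 0 ≤ k ^ 2 / (1 + k ^ 2)), Real.sqrt_div (sq_nonneg k),
    Real.sqrt_sq hk]

theorem continuous_rampPrimitive (c : ℝ) : Continuous (rampPrimitive c) := by
  unfold rampPrimitive
  have h : Continuous fun t : ℝ => t / √(1 + t ^ 2) := by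
    refine Continuous.div (by fun_prop) (by fun_prop) fun t => ?_
    positivity
  have h1 := Real.continuous_arcsin.comp (continuous_id.mul continuous_const :
    Continuous fun t : ℝ => t * √(c / (1 - c)))
  have h2 := Real.continuous_arcsin.comp (h.div_const √(1 - c))
  exact continuous_const.mul ((continuous_const.mul h1).add h2)

theorem hasDerivAt_div_sqrt_one_add_sq (t : ℝ) :
    HasDerivAt (fun t : ℝ => t / √(1 + t ^ 2)) (1 / ((1 + t ^ 2) * √(1 + t ^ 2))) t := by
  have hpos : (0 : ℝ) < 1 + t ^ 2 := by positivity
  have h : HasDerivAt (fun t : ℝ => 1 + t ^ 2) (2 * t) t := by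
    simpa using (hasDerivAt_pow 2 t).const_add 1
  have hs : 0 < √(1 + t ^ 2) := Real.sqrt_pos.2 hpos
  have hsq : √(1 + t ^ 2) ^ 2 = 1 + t ^ 2 := Real.sq_sqrt hpos.le
  refine ((hasDerivAt_id t).fun_div (h.sqrt hpos.ne') hs.ne').congr_deriv ?_
  rw [hsq]
  simp only [id]
  field_simp
  rw [hsq]
  ring

theorem hasDerivAt_rampPrimitive {α t : ℝ} (hα : 0 ≤ α)
    (hct : (α / (2 + α)) ^ 2 * (1 + t ^ 2) < 1) :
    HasDerivAt (rampPrimitive ((α / (2 + α)) ^ 2)) (rampRate α t) t := by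
  have hc0 : 0 ≤ α / (2 + α) := by positivity
  have hc1 := wachter_param_lt_one hα
  have hroot := sqrt_wachter_param hα
  have h2 : 1 - α / (2 + α) = 2 / (2 + α) := by field_simp; ring
  unfold rampRate rampPrimitive
  rw [hroot, h2]
  set r := α / (2 + α) with hr
  have hD : 0 < 1 - r ^ 2 := by linarith
  have hE : 0 < 1 - r ^ 2 * (1 + t ^ 2) := by linarith
  have hp : (0 : ℝ) < 1 + t ^ 2 := by positivity
  have sD : √(1 - r ^ 2) ^ 2 = 1 - r ^ 2 := Real.sq_sqrt hD.le
  have sp : √(1 + t ^ 2) ^ 2 = 1 + t ^ 2 := Real.sq_sqrt hp.le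
  have sE : √(1 - r ^ 2 * (1 + t ^ 2)) ^ 2 = 1 - r ^ 2 * (1 + t ^ 2) := Real.sq_sqrt hE.le
  have pD : 0 < √(1 - r ^ 2) := Real.sqrt_pos.2 hD
  have pp : 0 < √(1 + t ^ 2) := Real.sqrt_pos.2 hp
  have pE : 0 < √(1 - r ^ 2 * (1 + t ^ 2)) := Real.sqrt_pos.2 hE
  have hpi := Real.pi_pos
  have hq : √(r ^ 2 / (1 - r ^ 2)) = r / √(1 - r ^ 2) := by
    rw [Real.sqrt_div (sq_nonneg r), Real.sqrt_sq hc0]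
  rw [hq]
  have e1 : 1 - (t * (r / √(1 - r ^ 2))) ^ 2 = (1 - r ^ 2 * (1 + t ^ 2)) / (1 - r ^ 2) := by
    rw [mul_pow, div_pow, sD]; field_simp; ring
  have e2 : 1 - (t / √(1 + t ^ 2) / √(1 - r ^ 2)) ^ 2
      = (1 - r ^ 2 * (1 + t ^ 2)) / (1 + t ^ 2) / (1 - r ^ 2) := by
    rw [div_pow, div_pow, sD, sp]; field_simp; ring
  -- both arcsines are evaluated strictly inside `(-1, 1)`
  have hne : ∀ y : ℝ, 0 < 1 - y ^ 2 → y ≠ -1 ∧ y ≠ 1 := by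
    intro y hy
    constructor <;> rintro rfl <;> norm_num at hy
  have n1 := hne (t * (r / √(1 - r ^ 2))) (by rw [e1]; positivity)
  have n2 := hne (t / √(1 + t ^ 2) / √(1 - r ^ 2)) (by rw [e2]; positivity)
  have d1 := (Real.hasDerivAt_arcsin n1.1 n1.2).comp t
    ((hasDerivAt_id t).mul_const (r / √(1 - r ^ 2)))
  have d2 := (Real.hasDerivAt_arcsin n2.1 n2.2).comp t
    ((hasDerivAt_div_sqrt_one_add_sq t).div_const √(1 - r ^ 2))
  rw [e1, Real.sqrt_div hE.le] at d1
  rw [e2, Real.sqrt_div (by positivity), Real.sqrt_div hE.le] at d2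
  refine (((d1.const_mul (-r)).add d2).const_mul (2 / (Real.pi * (2 / (2 + α))))).congr_deriv ?_
  have h2α : 0 < 2 + α := by linarith
  set D := √(1 - r ^ 2)
  set P := √(1 + t ^ 2)
  set S := √(1 - r ^ 2 * (1 + t ^ 2))
  have : 1 + t ^ 2 = P ^ 2 := sp.symm
  have hS : S ^ 2 = 1 - r ^ 2 * P ^ 2 := by rw [sE, sp]
  rw [this]
  field_simp
  linear_combination -hS

theorem integral_rampRate {α k : ℝ} (hα : 0 ≤ α) (hk : 0 ≤ k)
    (hck : (α / (2 + α)) ^ 2 * (1 + k ^ 2) ≤ 1) :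
    ∫ t in (0 : ℝ)..k, rampRate α t = rampExpression ((α / (2 + α)) ^ 2) (1 / (1 + k ^ 2)) := by
  rw [intervalIntegral.integral_eq_sub_of_hasDerivAt_of_le hk
    (continuous_rampPrimitive ((α / (2 + α)) ^ 2)).continuousOn
    (fun t ht => hasDerivAt_rampPrimitive hα ?_)
    ((continuous_rampRate α).intervalIntegrable 0 k),
    rampPrimitive_eq (by positivity) (wachter_param_lt_one hα) hk hck]
  · simp [rampPrimitive]
  · rcases eq_or_lt_of_le (sq_nonneg (α / (2 + α))) with h | h
    · rw [← h]; norm_num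
    · refine lt_of_lt_of_le (mul_lt_mul_of_pos_left ?_ h) hck
      have := ht.1
      have := ht.2
      nlinarith

theorem rampExpression_self {c : ℝ} (hc1 : c < 1) : rampExpression c c = 1 := by
  have h : √c < 1 := by rw [Real.sqrt_lt' one_pos]; linarith
  have h' : 1 - √c ≠ 0 := by linarith
  rw [rampExpression, arctanSqrtRatio, if_pos (sub_self c), div_self (by linarith), Real.sqrt_one,
    Real.arcsin_one]
  have := Real.pi_ne_zero
  field_simp
  ring

/-- Past the critical point the ramp has reached its plateau. -/
theorem integral_rampRate_of_ge {α k kc : ℝ} (hα : 0 ≤ α) (hkc : 0 ≤ kc)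
    (hc : 1 / (1 + kc ^ 2) = (α / (2 + α)) ^ 2) (hk : kc ≤ k) :
    ∫ t in (0 : ℝ)..k, rampRate α t = 1 := by
  have hmul : (α / (2 + α)) ^ 2 * (1 + kc ^ 2) = 1 := by
    rw [← hc]; exact one_div_mul_cancel (by positivity)
  have hint := fun x y => (continuous_rampRate α).intervalIntegrable (μ := volume) x y
  rw [← intervalIntegral.integral_add_adjacent_intervals (hint 0 kc) (hint kc k),
    integral_rampRate hα hkc hmul.le, hc, rampExpression_self (wachter_param_lt_one hα)]
  have hzero : ∫ t in kc..k, rampRate α t = 0 := by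
    rw [← intervalIntegral.integral_zero (a := kc) (b := k) (μ := volume)]
    refine intervalIntegral.integral_congr fun t ht => ?_
    rw [Set.uIcc_of_le hk] at ht
    rw [rampRate, Real.sqrt_eq_zero_of_nonpos, mul_zero]
    have h1 : kc ^ 2 ≤ t ^ 2 := pow_le_pow_left₀ hkc ht.1 2
    have h2 := mul_le_mul_of_nonneg_left h1 (sq_nonneg (α / (2 + α)))
    linarith
  rw [hzero, add_zero]

end Ramp

theorem tendsto_lueStructureFunction {α k : ℝ} (hα : 0 ≤ α) (hk : 0 ≤ k) :
    Tendsto (fun N : ℕ => 1 / (N : ℝ) * lueStructureFunction N (α * N) k) atTop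
      (𝓝 (∫ t in (0 : ℝ)..k, rampRate α t)) := by
  refine (tendsto_sub_cornerNormSq hα hk).congr' ?_
  filter_upwards [eventually_gt_atTop 0] with N hN
  rw [lueStructureFunction_eq (by positivity) hN]

theorem corollary1 (α : ℝ) (hα : 0 ≤ α) (c : ℝ) (hc : c = (α / (2 + α)) ^ 2) :
    (0 ≤ c ∧ c < 1) ∧
    (∀ k : ℝ, 0 ≤ k →
      IntervalIntegrable (wachterDensity c) volume (1 / (1 + k ^ 2)) 1 ∧
      Tendsto (fun N : ℕ => 1 / (N : ℝ) * lueStructureFunction N (α * N) k) atTop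
        (𝓝 (∫ x in (1 / (1 + k ^ 2))..1, wachterDensity c x))) ∧
    (α = 0 → ∀ k : ℝ, 0 ≤ k →
      (∫ x in (1 / (1 + k ^ 2))..1, wachterDensity c x) = rampExpression c (1 / (1 + k ^ 2))) ∧
    (0 < α → ∃! kc : ℝ, 0 ≤ kc ∧ 1 / (1 + kc ^ 2) = c) ∧
    (∀ kc : ℝ, 0 ≤ kc → 1 / (1 + kc ^ 2) = c →
      (∀ k : ℝ, 0 ≤ k → k ≤ kc →
        (∫ x in (1 / (1 + k ^ 2))..1, wachterDensity c x) = rampExpression c (1 / (1 + k ^ 2))) ∧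
      (∀ k : ℝ, kc ≤ k →
        Tendsto (fun N : ℕ => 1 / (N : ℝ) * lueStructureFunction N (α * N) k) atTop
          (𝓝 1))) := by
  subst hc
  refine ⟨⟨sq_nonneg _, wachter_param_lt_one hα⟩, fun k hk => ⟨?_, ?_⟩, ?_, fun hα0 => ?_, ?_⟩
  · exact intervalIntegrable_wachterDensity hα hk
  · rw [integral_wachterDensity hα hk]
    exact tendsto_lueStructureFunction hα hk
  · intro h0 k hk
    rw [integral_wachterDensity hα hk]
    exact integral_rampRate hα hk (by simp [h0])
  · have hc0 : 0 < (α / (2 + α)) ^ 2 := by positivity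
    have hc1 := wachter_param_lt_one hα
    set c := (α / (2 + α)) ^ 2
    have h1 : 1 < 1 / c := by rwa [lt_div_iff₀ hc0, one_mul]
    refine ⟨√(1 / c - 1), ⟨Real.sqrt_nonneg _, ?_⟩, ?_⟩
    · rw [Real.sq_sqrt (by linarith), add_sub_cancel, one_div_one_div]
    · rintro y ⟨hy0, hy⟩
      rw [← hy, one_div_one_div, add_sub_cancel_left, Real.sqrt_sq hy0]
  · intro kc hkc hkc'
    refine ⟨fun k hk hkk => ?_, fun k hk => ?_⟩
    · rw [integral_wachterDensity hα hk]
      refine integral_rampRate hα hk ?_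
      rw [← hkc', one_div_mul_eq_div, div_le_one (by positivity)]
      have := pow_le_pow_left₀ hk hkk 2
      linarith
    · exact integral_rampRate_of_ge hα hkc hkc' hk ▸
        tendsto_lueStructureFunction hα (hkc.trans hk)
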